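/- For a finite group $G$, let $\mathrm{sp}(G)$ (the genus spectrum) be the set of integers $g\ge 2$ for which there exist integers $h,r\ge 0$, integers $n_1,\dots,n_r\ge 2$ with $$2(g-1)=|G|\Bigl(2(h-1)+\sum_{j=1}^r\bigl(1-\tfrac1{n_j}\bigr)\Bigr),$$ and elements $a_1,b_1,\dots,a_h,b_h,c_1,\dots,c_r$ generating $G$ such that $\prod_i[a_i,b_i]\prod_j c_j=1$ and $c_j$ has order $n_j$ for all $j$. The genus increment $N_G$ is the positive integer $N$ such that $\mathrm{sp}(G)\subseteq 1+N\mathbb Z$ and $(1+N\mathbb N)\setminus \mathrm{sp}(G)$ is finite. The minimum genus is $\mu(G)=\min \mathrm{sp}(G)$, and the stable upper genus is $\sigma(G)=\min\{g\in\mathrm{sp}(G): g+N_G\mathbb N_0\subseteq \mathrm{sp}(G)\}$. **Theorem.** Let $e\ge 5$. A group $G$ is a $2$-group of order $2^{e+1}$ and of maximal class (that is, of nilpotency class $e$) if and only if it is isomorphic to one of - the dihedral group $D=\langle y,x : x^2=1=y^{2^e},\ x^{-1}yx=y^{-1}\rangle$, - the generalized quaternion group $Q=\langle y,x : x^2=y^{2^{e-1}},\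 x^4=1,\ x^{-1}yx=y^{-1}\rangle$, - the semidihedral group $S=\langle y,x : x^2=1=y^{2^e},\ x^{-1}yx=y^{2^{e-1}-1}\rangle$. For every such $G$ one has $N_G=1$. Moreover: - if $G\cong D$, then $\mu(G)=2^{e-1}$ and $\sigma(G)=(e-3)2^e+4$; - if $G\cong Q$, then $\mu(G)=2^{e-1}$ and $\sigma(G)=(e-3)2^e+2^{e-1}+3$; - if $G\cong S$, then $\mu(G)=2^{e-2}$ and $\sigma(G)=(e-3)2^e+2^{e-2}+3$. The genus spectra of $D$, $Q$ and $S$ are pairwise different. -/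

import Mathlib

/-- The genus spectrum of a finite group `G`: the integers `g ≥ 2` for which there are `h`, periods
`n₁, …, n_r ≥ 2` satisfying the Riemann-Hurwitz relation, and a generating system
`a₁, b₁, …, a_h, b_h, c₁, …, c_r` of `G` with `∏ [aᵢ, bᵢ] · ∏ cⱼ = 1` and `|cⱼ| = nⱼ`.
By Riemann's existence theorem these are the `g ≥ 2` such that `G` acts faithfully and
orientation-preservingly on a closed orientable surface of genus `g`. -/
def genusSpectrum (G : Type*) [Group G] : Set ℕ :=
  {g | 2 ≤ g ∧ ∃ (h r : ℕ) (n : Fin r → ℕ),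
    (∀ j, 2 ≤ n j) ∧
    2 * ((g : ℚ) - 1) =
      (Nat.card G : ℚ) * (2 * ((h : ℚ) - 1) + ∑ j, (1 - 1 / (n j : ℚ))) ∧
    ∃ (a b : Fin h → G) (c : Fin r → G),
      Subgroup.closure (Set.range a ∪ Set.range b ∪ Set.range c) = ⊤ ∧
      (List.ofFn fun i => a i * b i * (a i)⁻¹ * (b i)⁻¹).prod * (List.ofFn c).prod = 1 ∧
      ∀ j, orderOf (c j) = n j}

/-- `N` is the genus increment of `G`: every genus of `G` is congruent to `1` modulo `N`, and all
but finitely many elements of `1 + N ℕ` are genera of `G`. -/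
def IsGenusIncrement (G : Type*) [Group G] (N : ℕ) : Prop :=
  0 < N ∧ (∀ g ∈ genusSpectrum G, g ≡ 1 [MOD N]) ∧
    ({g : ℕ | ∃ k : ℕ, g = 1 + N * k} \ genusSpectrum G).Finite

/-- The genus increment is unique. -/
theorem IsGenusIncrement.unique {G : Type*} [Group G] {M N : ℕ}
    (hM : IsGenusIncrement G M) (hN : IsGenusIncrement G N) : M = N := by
  have key : ∀ {A B : ℕ}, IsGenusIncrement G A → IsGenusIncrement G B → B ∣ A := by
    intro A B hA hB
    obtain ⟨b, hb⟩ := hA.2.2.bddAbove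
    have mem : ∀ k, b < k → 1 + A * k ∈ genusSpectrum G := by
      intro k hk
      by_contra hc
      have h1 : 1 + A * k ≤ b := hb ⟨⟨k, rfl⟩, hc⟩
      have h2 : k ≤ A * k := Nat.le_mul_of_pos_left k hA.1
      omega
    have h1 := hB.2.1 _ (mem (b + 1) (by omega))
    have h2 := hB.2.1 _ (mem (b + 2) (by omega))
    have h3 := (Nat.modEq_iff_dvd' (by gcongr; omega)).1 (h1.trans h2.symm)
    have h4 : 1 + A * (b + 2) - (1 + A * (b + 1)) = A := by
      have : A * (b + 2) = A * (b + 1) + A := by ring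
      omega
    rwa [h4] at h3
  exact Nat.dvd_antisymm (key hN hM) (key hM hN)

/-- `m` is the minimum genus `μ(G) = min sp(G)`. -/
def IsMinimumGenus (G : Type*) [Group G] (m : ℕ) : Prop :=
  IsLeast (genusSpectrum G) m

/-- `s` is the stable upper genus `σ(G) = min {g ∈ sp(G) : g + N ℕ₀ ⊆ sp(G)}`, where `N` is the
genus increment of `G`. -/
def IsStableUpperGenus (G : Type*) [Group G] (s : ℕ) : Prop :=
  ∃ N, IsGenusIncrement G N ∧
    IsLeast {g | g ∈ genusSpectrum G ∧ ∀ k : ℕ, g + N * k ∈ genusSpectrum G} s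

/-- `G` is a `p`-group of order `p ^ (c + 1)` and of maximal class: its nilpotency class is `c`. -/
def IsOfMaximalClass (p c : ℕ) (G : Type*) [Group G] : Prop :=
  Nat.card G = p ^ (c + 1) ∧ ∃ _ : Group.IsNilpotent G, Group.nilpotencyClass G = c

/-- The semidihedral group of order `8n`, with presentation
`⟨y, x ∣ x² = 1 = y⁴ⁿ, x⁻¹ y x = y²ⁿ⁻¹⟩`. Here `r i` stands for `yⁱ` and `sr i` for `x yⁱ`.
It is a semidihedral `2`-group of order `2 ^ (e + 1)` when `n = 2 ^ (e - 2)`, `e ≥ 3`. -/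
inductive SemidihedralGroup (n : ℕ) : Type
  | r : ZMod (4 * n) → SemidihedralGroup n
  | sr : ZMod (4 * n) → SemidihedralGroup n

namespace SemidihedralGroup

variable {n : ℕ}

/-- The exponent `2n - 1` by which `x` acts on `y`. -/
def twist (n : ℕ) : ZMod (4 * n) := 2 * (n : ZMod (4 * n)) - 1

theorem twist_mul_self (n : ℕ) : twist n * twist n = 1 := by
  have h : (4 : ZMod (4 * n)) * (n : ZMod (4 * n)) = 0 := by
    have := ZMod.natCast_self (4 * n)
    push_cast at this
    exact this
  unfold twist
  linear_combination ((n : ZMod (4 * n)) - 1) * h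

/-- The multiplication forced by `y x = x y²ⁿ⁻¹`. -/
protected def mul : SemidihedralGroup n → SemidihedralGroup n → SemidihedralGroup n
  | r i, r j => r (i + j)
  | r i, sr j => sr (twist n * i + j)
  | sr i, r j => sr (i + j)
  | sr i, sr j => r (twist n * i + j)

/-- Inversion. -/
protected def inv : SemidihedralGroup n → SemidihedralGroup n
  | r i => r (-i)
  | sr i => sr (-(twist n * i))

instance : Mul (SemidihedralGroup n) := ⟨SemidihedralGroup.mul⟩

instance : One (SemidihedralGroup n) := ⟨r 0⟩

instance : Inv (SemidihedralGroup n) := ⟨SemidihedralGroup.inv⟩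

theorem one_def : (1 : SemidihedralGroup n) = r 0 := rfl

@[simp] theorem r_mul_r (i j : ZMod (4 * n)) : r i * r j = r (i + j) := rfl

@[simp] theorem r_mul_sr (i j : ZMod (4 * n)) : r i * sr j = sr (twist n * i + j) := rfl

@[simp] theorem sr_mul_r (i j : ZMod (4 * n)) : sr i * r j = sr (i + j) := rfl

@[simp] theorem sr_mul_sr (i j : ZMod (4 * n)) : sr i * sr j = r (twist n * i + j) := rfl

@[simp] theorem inv_r (i : ZMod (4 * n)) : (r i)⁻¹ = r (-i) := rfl

@[simp] theorem inv_sr (i : ZMod (4 * n)) : (sr i)⁻¹ = sr (-(twist n * i)) := rfl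

instance : Group (SemidihedralGroup n) :=
  Group.ofLeftAxioms
    (by
      have h := twist_mul_self n
      rintro (i | i) (j | j) (k | k) <;>
        simp only [r_mul_r, r_mul_sr, sr_mul_r, sr_mul_sr, r.injEq, sr.injEq] <;>
        first
          | ring1
          | linear_combination i * h)
    (by rintro (i | i) <;> simp [one_def])
    (by
      have h := twist_mul_self n
      rintro (i | i) <;>
        simp only [one_def, inv_r, inv_sr, r_mul_r, sr_mul_sr, r.injEq]
      · ring
      · linear_combination -i * h)

/-- The elements `x = sr 0` and `y = r 1` satisfy the defining relations. -/
theorem relations (n : ℕ) (hn : 0 < n) :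
    (sr 0 : SemidihedralGroup n) ^ 2 = 1 ∧ (r 1 : SemidihedralGroup n) ^ (4 * n) = 1 ∧
      (sr 0 : SemidihedralGroup n)⁻¹ * r 1 * sr 0 = r 1 ^ (2 * n - 1) := by
  have hp : ∀ k : ℕ, (r 1 : SemidihedralGroup n) ^ k = r (k : ZMod (4 * n)) := by
    intro k
    induction k with
    | zero => simp [one_def]
    | succ k ih => rw [pow_succ, ih, r_mul_r]; push_cast; rfl
  refine ⟨by simp [pow_two, one_def], ?_, ?_⟩
  · rw [hp, ZMod.natCast_self, one_def]
  · rw [hp, Nat.cast_sub (by omega)]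
    simp [twist]

/-- The semidihedral group with parameter `n` has order `8n`. -/
theorem card_eq (n : ℕ) : Nat.card (SemidihedralGroup n) = 8 * n := by
  have e : SemidihedralGroup n ≃ ZMod (4 * n) ⊕ ZMod (4 * n) :=
    { toFun := fun g => match g with
        | r i => Sum.inl i
        | sr i => Sum.inr i
      invFun := fun s => match s with
        | Sum.inl i => r i
        | Sum.inr i => sr i
      left_inv := by rintro (i | i) <;> rfl
      right_inv := by rintro (i | i) <;> rfl }
  rw [Nat.card_congr e]
  rcases Nat.eq_zero_or_pos n with rfl | hn
  · have : Infinite (ZMod (4 * 0)) := inferInstanceAs (Infinite ℤ)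
    simp
  · have : NeZero (4 * n) := ⟨by omega⟩
    rw [Nat.card_sum, Nat.card_zmod]
    ring

end SemidihedralGroup

/-! Write `e = n + 1`. The three groups share one shape: a cyclic subgroup `⟨y⟩` of order `2 ^ (n +
1)` and index two, and `x` outside it with `y x = x yᵗ`, `x² = yᵐ`, `t ≡ 3 mod 4`. In the
Riemann-Hurwitz formula, divided by two, a branch element of order `k` contributes the weight `2 ^
(n + 1) (1 - 1 / k)`. A nontrivial element of `⟨y²⟩` has weight twice a generator `2 ^ n - 2 ^ j` of
a numerical semigroup `W`, an odd power of `y` has weight `2 ^ (n + 1) - 1`, and the elements `x yᵏ`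
with `k` even or odd have weights `2α` and `2β`.

Let `T`, `u`, `v` be the numbers of branch elements in the three nontrivial classes of `G / ⟨y²⟩`, a
Klein four-group. As commutators vanish there, the product relation forces `T`, `u`, `v` to have
equal parity. Odd counts give the genera `2q + 2a` with `a ∈ W` and `q = α + β - 2 ^ n`. Even counts
give `1 + 4q + 2a` and `2 ^ (n + 1) - 1 + 2a`: on the sphere the branch elements must escape all
three maximal subgroups, and with one handle they cannot all lie in `⟨y⁴⟩`. Conversely all these
values from 2 on occur (`exists_of_mem_spectrum`, `mem_spectrum_of_exists`). So the spectrum depends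
only on `n` and on `q`, which is `0`, `2 ^ (n - 1)`, `2 ^ (n - 2)` for `D`, `Q`, `S`.

The rest is arithmetic of `W`. Its Frobenius number is `F = (n - 2) 2 ^ n + 1`, so the largest even
gap is `2F + 2q`. For `q = 0` the largest odd gap is `2F + 1`. For `Q` and `S` the two odd families
cover each other's gaps beyond `2F + 2q`, because the gaps of `W` near `F` lie in one residue class
(`mem_of_mod_ne`).

The classification is by induction on the centre: in maximal class the centre has order two, a
cyclic subgroup of index two lifts from the central quotient, and the possible parameters `t`, `m`
are then few. -/

/-! ### The semigroup of half-weights and its Frobenius number -/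

/-- The numerical semigroup generated by `2 ^ n - 2 ^ j`, `j < n`. -/
def weightMonoid (n : ℕ) : AddSubmonoid ℕ :=
  AddSubmonoid.closure {v | ∃ j < n, v = 2 ^ n - 2 ^ j}

namespace weightMonoid

variable {n : ℕ}

theorem gen_mem {j : ℕ} (hj : j < n) : 2 ^ n - 2 ^ j ∈ weightMonoid n :=
  AddSubmonoid.subset_closure ⟨j, hj, rfl⟩

theorem half_mem (hn : 1 ≤ n) : 2 ^ (n - 1) ∈ weightMonoid n := by
  obtain ⟨k, rfl⟩ := Nat.exists_eq_add_of_le' hn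
  have h := gen_mem (n := k + 1) (j := k) (by omega)
  have e : 2 ^ (k + 1) - 2 ^ k = 2 ^ (k + 1 - 1) := by
    rw [pow_succ, Nat.add_sub_cancel]; omega
  rwa [e] at h

theorem pow_mem (hn : 1 ≤ n) : 2 ^ n ∈ weightMonoid n := by
  have h := add_mem (half_mem hn) (half_mem hn)
  obtain ⟨k, rfl⟩ := Nat.exists_eq_add_of_le' hn
  rwa [Nat.add_sub_cancel, ← two_mul, ← pow_succ'] at h

theorem mul_pow_mem (hn : 1 ≤ n) (k : ℕ) : k * 2 ^ n ∈ weightMonoid n :=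
  nsmul_mem (pow_mem hn) k

theorem pow_sub_one_mem (hn : 1 ≤ n) : 2 ^ n - 1 ∈ weightMonoid n :=
  gen_mem (j := 0) (by omega)

/-- A number `k 2ⁿ - r` with `r < 2 ^ d` and `d ≤ k` belongs to the semigroup. -/
theorem mem_of_add_eq (hn : 1 ≤ n) (d : ℕ) : d ≤ n → ∀ {x r k : ℕ}, r < 2 ^ d → d ≤ k →
    x + r = k * 2 ^ n → x ∈ weightMonoid n := by
  induction d with
  | zero =>
    intro _ x r k hr _ h
    have : x = k * 2 ^ n := by simp at hr; omega
    exact this ▸ mul_pow_mem hn k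
  | succ d ih =>
    intro hd x r k hr hk h
    -- Read `r` in binary: each of its at most `d + 1` ones is subtracted from a separate copy of `2
    -- ^ n`. The leading digit is split off here.
    by_cases hb : r < 2 ^ d
    · exact ih (by omega) hb (by omega) h
    · obtain ⟨k, rfl⟩ := Nat.exists_eq_add_of_le' (show 1 ≤ k by omega)
      have hp : 2 ^ (d + 1) ≤ 2 ^ n := Nat.pow_le_pow_right (by norm_num) hd
      have e1 : 2 ^ (d + 1) = 2 * 2 ^ d := pow_succ' 2 d
      have hkn : 2 ^ n ≤ (k + 1) * 2 ^ n := Nat.le_mul_of_pos_left _ (by omega)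
      have e2 : (k + 1) * 2 ^ n = k * 2 ^ n + 2 ^ n := by ring
      rcases Nat.eq_zero_or_pos k with rfl | hk0
      · have hd0 : d = 0 := by omega
        subst hd0
        have : x = 2 ^ n - 1 := by simp at hr hb; simp at h; omega
        exact this ▸ pow_sub_one_mem hn
      · have hkk : 2 ^ n ≤ k * 2 ^ n := Nat.le_mul_of_pos_left _ hk0
        have := add_mem (gen_mem (n := n) (j := d) (by omega))
          (ih (by omega) (x := x + 2 ^ d - 2 ^ n) (r := r - 2 ^ d) (k := k) (by omega)
            (by omega) (by omega))
        have e3 : 2 ^ n - 2 ^ d + (x + 2 ^ d - 2 ^ n) = x := by omega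
        rwa [e3] at this

/-- If `r < 2 ^ d - 1`, a summand less is needed. -/
theorem mem_of_add_eq' (hn : 1 ≤ n) (d : ℕ) : d ≤ n → ∀ {x r k : ℕ}, r + 1 < 2 ^ d → d ≤ k + 1 →
    x + r = k * 2 ^ n → x ∈ weightMonoid n := by
  induction d with
  | zero => intro _ x r k hr; simp at hr
  | succ d ih =>
    intro hd x r k hr hk h
    -- Now `r` is not `2 ^ (d + 1) - 1`, so one of its `d + 1` digits is zero and one copy of `2 ^
    -- n` is saved. If the leading digit is the zero, the previous lemma applies; otherwise the zero
    -- is further down.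
    by_cases hb : r < 2 ^ d
    · exact mem_of_add_eq hn d (by omega) hb (by omega) h
    · have hp : 2 ^ (d + 1) ≤ 2 ^ n := Nat.pow_le_pow_right (by norm_num) hd
      have e1 : 2 ^ (d + 1) = 2 * 2 ^ d := pow_succ' 2 d
      have hd0 : 1 ≤ d := by
        by_contra hc
        have : d = 0 := by omega
        subst this
        simp at hb hr
        omega
      obtain ⟨k, rfl⟩ := Nat.exists_eq_add_of_le' (show 1 ≤ k by omega)
      have e2 : (k + 1) * 2 ^ n = k * 2 ^ n + 2 ^ n := by ring
      rcases Nat.eq_zero_or_pos k with rfl | hk0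
      · have hd1 : d = 1 := by omega
        subst hd1
        have : x = 2 ^ n - 2 ^ 1 := by simp at hr hb; simp at h; omega
        exact this ▸ gen_mem (by omega)
      · have hkk : 2 ^ n ≤ k * 2 ^ n := Nat.le_mul_of_pos_left _ hk0
        have := add_mem (gen_mem (n := n) (j := d) (by omega))
          (ih (by omega) (x := x + 2 ^ d - 2 ^ n) (r := r - 2 ^ d) (k := k) (by omega)
            (by omega) (by omega))
        have e3 : 2 ^ n - 2 ^ d + (x + 2 ^ d - 2 ^ n) = x := by omega
        rwa [e3] at this

/-- A sum of powers `2 ^ j`, `j < n`, that is congruent to `-1` modulo `2 ^ n` has many summands. -/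
theorem le_card_of_sum_eq (n : ℕ) : ∀ (t : ℕ → ℕ) (q : ℕ),
    ∑ j ∈ Finset.range (n + 1), t j * 2 ^ j + 1 = (q + 1) * 2 ^ (n + 1) →
    2 * q + n + 1 ≤ ∑ j ∈ Finset.range (n + 1), t j := by
  induction n with
  | zero => intro t q h; simp at h ⊢; omega
  | succ n ih =>
    intro t q h
    rw [Finset.sum_range_succ'] at h ⊢
    have e1 : ∑ j ∈ Finset.range (n + 1), t (j + 1) * 2 ^ (j + 1) =
        2 * ∑ j ∈ Finset.range (n + 1), t (j + 1) * 2 ^ j := by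
      rw [Finset.mul_sum]; exact Finset.sum_congr rfl fun j _ => by ring
    have e2 : (q + 1) * 2 ^ (n + 1 + 1) = 2 * ((q + 1) * 2 ^ (n + 1)) := by ring
    rw [e1, e2, pow_zero, mul_one] at h
    -- Parity makes `t 0` odd. Carrying `u` pairs of ones into the next place and using the last one
    -- to absorb the `+ 1` halves the equation, at the cost of `u + 1` summands.
    obtain ⟨u, hu⟩ : ∃ u, t 0 = 2 * u + 1 := ⟨t 0 / 2, by omega⟩
    have h1 := ih (fun j => if j = 0 then t 1 + u else t (j + 1)) q (by
      rw [Finset.sum_range_succ'] at h ⊢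
      simp only [Nat.add_eq_zero_iff, one_ne_zero, and_false, if_false, if_true]
      simp only [pow_zero, mul_one, zero_add] at h ⊢
      omega)
    rw [Finset.sum_range_succ'] at h1 ⊢
    simp only [Nat.add_eq_zero_iff, one_ne_zero, and_false, if_false, if_true, zero_add] at h1 ⊢
    omega

theorem exists_coeff {x : ℕ} (hx : x ∈ weightMonoid n) : ∃ t : ℕ → ℕ,
    x + ∑ j ∈ Finset.range n, t j * 2 ^ j = (∑ j ∈ Finset.range n, t j) * 2 ^ n := by
  induction hx using AddSubmonoid.closure_induction with
  | mem v hv =>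
    obtain ⟨j, hj, rfl⟩ := hv
    refine ⟨Pi.single j 1, ?_⟩
    have hp : 2 ^ j ≤ 2 ^ n := Nat.pow_le_pow_right (by norm_num) hj.le
    have e1 : ∑ i ∈ Finset.range n, (Pi.single j 1 : ℕ → ℕ) i * 2 ^ i = 2 ^ j := by
      rw [Finset.sum_eq_single j] <;> simp +contextual [hj]
    have e2 : ∑ i ∈ Finset.range n, (Pi.single j 1 : ℕ → ℕ) i = 1 := by
      rw [Finset.sum_eq_single j] <;> simp +contextual [hj]
    rw [e1, e2]; omega
  | zero => exact ⟨0, by simp⟩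
  | add x y _ _ hx hy =>
    obtain ⟨t, ht⟩ := hx
    obtain ⟨s, hs⟩ := hy
    refine ⟨t + s, ?_⟩
    simp only [Pi.add_apply, add_mul, Finset.sum_add_distrib]
    omega

/-- The Frobenius number is not in the semigroup. -/
theorem frobenius_notMem (hn : 2 ≤ n) : (n - 2) * 2 ^ n + 1 ∉ weightMonoid n := by
  intro hx
  obtain ⟨t, ht⟩ := exists_coeff hx
  obtain ⟨d, rfl⟩ := Nat.exists_eq_add_of_le' hn
  rw [Nat.add_sub_cancel] at ht
  set N := ∑ j ∈ Finset.range (d + 2), t j with hN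
  set s := ∑ j ∈ Finset.range (d + 2), t j * 2 ^ j with hs
  have hlt : d < N := by
    by_contra hc
    have := Nat.mul_le_mul_right (2 ^ (d + 2)) (not_lt.1 hc)
    omega
  obtain ⟨q, hq⟩ := Nat.exists_eq_add_of_le hlt
  -- With `N = d + 1 + q` generators the subtracted powers sum to `(q + 1) 2 ^ (d + 2) - 1`, which
  -- needs at least `2q + d + 2 > N` summands.
  have h1 : s + 1 = (q + 1) * 2 ^ (d + 1 + 1) := by
    rw [hq] at ht
    have : (d.succ + q) * 2 ^ (d + 2) = d * 2 ^ (d + 2) + (q + 1) * 2 ^ (d + 2) := by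
      rw [Nat.succ_eq_add_one]; ring
    rw [this] at ht
    show s + 1 = (q + 1) * 2 ^ (d + 2)
    omega
  have := le_card_of_sum_eq (d + 1) t q h1
  rw [← hN] at this
  omega

/-- Near the Frobenius number, the gaps lie in a single residue class modulo `2 ^ (n - 1)`. -/
theorem mem_of_mod_ne (hn : 2 ≤ n) {x : ℕ} (hx : (n - 2) * 2 ^ n + 1 ≤ x + 2 ^ (n - 1))
    (hmod : x % 2 ^ (n - 1) ≠ 1 % 2 ^ (n - 1)) : x ∈ weightMonoid n := by
  obtain ⟨d, rfl⟩ := Nat.exists_eq_add_of_le' hn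
  have e0 : d + 2 - 1 = d + 1 := rfl
  rw [Nat.add_sub_cancel, e0] at hx
  rw [e0] at hmod
  set M := 2 ^ (d + 1) with hM
  have hM2 : 2 ^ (d + 2) = 2 * M := pow_succ' 2 (d + 1)
  have hM0 : 0 < M := by positivity
  have hM3 : 2 ≤ M := by rw [hM, pow_succ']; have := Nat.two_pow_pos d; omega
  have hx' : d * (2 * M) + 1 ≤ x + M := by rwa [hM2] at hx
  obtain ⟨r, u, hr, hxu⟩ : ∃ r u, r < M ∧ x + r = u * M := by
    refine ⟨(M - x % M) % M, (x + (M - x % M) % M) / M, Nat.mod_lt _ hM0, ?_⟩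
    rw [Nat.div_mul_cancel]
    have h1 := Nat.mod_lt x hM0
    rw [Nat.dvd_iff_mod_eq_zero, Nat.add_mod, Nat.mod_mod]
    by_cases h0 : x % M = 0
    · simp [h0]
    · rw [Nat.mod_eq_of_lt (show M - x % M < M by omega), Nat.add_sub_cancel' h1.le, Nat.mod_self]
  -- The excluded residue is exactly `r = M - 1`, the only `r < M` all of whose `d + 1` binary
  -- digits are one. Otherwise `d` copies of `2 ^ (d + 2)` suffice.
  have hr1 : r + 1 < M := by
    by_contra hc
    have hrM : r + 1 = M := by omega
    apply hmod
    have hu1 : x + M = u * M + 1 := by omega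
    have : (x + M) % M = 1 % M := by rw [hu1, add_comm, Nat.add_mul_mod_self_right]
    simpa using this
  have hud : 2 * d ≤ u := by
    by_contra hc
    have h2 : u + 1 ≤ 2 * d := by omega
    have := Nat.mul_le_mul_right M h2
    have e3 : 2 * d * M = d * (2 * M) := by ring
    have e4 : (u + 1) * M = u * M + M := by ring
    omega
  have key : ∀ k, d ≤ k → ∀ z, z + r = k * 2 ^ (d + 2) → z ∈ weightMonoid (d + 2) := fun k hk z hz =>
    mem_of_add_eq' (by omega) (d + 1) (by omega) hr1 (by omega) hz
  obtain ⟨k, hk | hk⟩ : ∃ k, u = 2 * k ∨ u = 2 * k + 1 := ⟨u / 2, by omega⟩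
  · exact key k (by omega) x (by rw [hxu, hM2, hk]; ring)
  · have hkM : (2 * k + 1) * M = k * (2 * M) + M := by ring
    rcases Nat.eq_zero_or_pos k with rfl | hk0
    · have hd0 : d = 0 := by omega
      subst hd0
      have : x = 2 ^ (0 + 2 - 1) := by
        simp at hM; simp [hk] at hxu; simp; omega
      exact this ▸ half_mem (n := 0 + 2) (by norm_num)
    · have hkk : 2 * M ≤ k * (2 * M) := Nat.le_mul_of_pos_left _ hk0
      rw [hk, hkM] at hxu
      have h1 := key k (by omega) (x - M) (by rw [hM2]; omega)
      have h2 := add_mem h1 (half_mem (n := d + 2) (by omega))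
      have e3 : x - M + 2 ^ (d + 2 - 1) = x := by
        rw [e0, ← hM]; omega
      rwa [e3] at h2

/-- Everything above the Frobenius number is in the semigroup. -/
theorem mem_of_frobenius_lt (hn : 2 ≤ n) {x : ℕ} (hx : (n - 2) * 2 ^ n + 1 < x) :
    x ∈ weightMonoid n := by
  by_cases hmod : x % 2 ^ (n - 1) = 1 % 2 ^ (n - 1)
  · obtain ⟨d, rfl⟩ := Nat.exists_eq_add_of_le' hn
    have e0 : d + 2 - 1 = d + 1 := rfl
    rw [Nat.add_sub_cancel] at hx
    rw [e0] at hmod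
    have hM2 : 2 ^ (d + 2) = 2 * 2 ^ (d + 1) := pow_succ' 2 (d + 1)
    have hfx : (2 ^ (d + 1)) ∣ x - (d * 2 ^ (d + 2) + 1) := by
      refine (Nat.modEq_iff_dvd' hx.le).1 ?_
      show (d * 2 ^ (d + 2) + 1) % 2 ^ (d + 1) = x % 2 ^ (d + 1)
      rw [hmod, hM2, add_comm, show d * (2 * 2 ^ (d + 1)) = (2 * d) * 2 ^ (d + 1) by ring,
        Nat.add_mul_mod_self_right]
    obtain ⟨u, hu⟩ := hfx
    obtain ⟨u, rfl⟩ : ∃ v, u = v + 1 := ⟨u - 1, by rcases u with _ | u <;> simp at hu ⊢; omega⟩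
    -- This number is the Frobenius number plus `2 ^ (d + 1)`. Larger numbers in its residue class
    -- follow by adding the element `2 ^ (d + 1)` of the semigroup.
    have h1 : (d + 1) * 2 ^ (d + 2) - (2 ^ (d + 1) - 1) ∈ weightMonoid (d + 2) :=
      mem_of_add_eq (by omega) (d + 1) (by omega) (r := 2 ^ (d + 1) - 1) (k := d + 1)
        (by have := Nat.two_pow_pos (d + 1); omega) le_rfl (by
          have : 2 ^ (d + 2) ≤ (d + 1) * 2 ^ (d + 2) := Nat.le_mul_of_pos_left _ (by omega)
          omega)
    have h2 := add_mem h1 (nsmul_mem (half_mem (n := d + 2) (by omega)) u)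
    rw [e0, smul_eq_mul] at h2
    have e3 : (d + 1) * 2 ^ (d + 2) - (2 ^ (d + 1) - 1) + u * 2 ^ (d + 1) = x := by
      have e4 : (d + 1) * 2 ^ (d + 2) = d * 2 ^ (d + 2) + 2 ^ (d + 2) := by ring
      have e5 : 2 ^ (d + 1) * (u + 1) = u * 2 ^ (d + 1) + 2 ^ (d + 1) := by ring
      have := Nat.two_pow_pos (d + 1)
      omega
    rwa [e3] at h2
  · exact mem_of_mod_ne hn (by omega) hmod

theorem half_le_of_mem {x : ℕ} (hx : x ∈ weightMonoid n) (h0 : x ≠ 0) : 2 ^ (n - 1) ≤ x := by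
  induction hx using AddSubmonoid.closure_induction with
  | mem v hv =>
    obtain ⟨j, hj, rfl⟩ := hv
    obtain ⟨d, rfl⟩ := Nat.exists_eq_add_of_le' (show 1 ≤ n by omega)
    have hp : 2 ^ j ≤ 2 ^ d := Nat.pow_le_pow_right (by norm_num) (by omega)
    rw [Nat.add_sub_cancel, pow_succ']; omega
  | zero => exact absurd rfl h0
  | add x y _ _ hx hy =>
    by_cases h : x = 0
    · have := hy (by omega); omega
    · have := hx h; omega

end weightMonoid

/-! ### Groups with a cyclic subgroup of index two: normal forms, maximal subgroups, weights -/

/-- The group `G`, of order `2 ^ (n + 2)`, is generated by `y`, of order `2 ^ (n + 1)`, and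
`x ∉ ⟨y⟩`, with `x⁻¹ y x = yᵗ` and `x² = yᵐ`. -/
structure IsMetacyclicPair {G : Type*} [Group G] (n : ℕ) (t m : ℤ) (y x : G) : Prop where
  card : Nat.card G = 2 ^ (n + 2)
  ord : orderOf y = 2 ^ (n + 1)
  notMem : x ∉ Subgroup.zpowers y
  comm : y * x = x * y ^ t
  sq : x * x = y ^ m

namespace IsMetacyclicPair

variable {G : Type*} [Group G] {n : ℕ} {t m : ℤ} {y x : G}

theorem finite (H : IsMetacyclicPair n t m y x) : Finite G :=
  Nat.finite_of_card_ne_zero (by rw [H.card]; positivity)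

theorem index (H : IsMetacyclicPair n t m y x) : (Subgroup.zpowers y).index = 2 := by
  have h := (Subgroup.zpowers y).card_mul_index
  rw [Nat.card_zpowers, H.ord, H.card, pow_succ 2 (n + 1)] at h
  exact Nat.eq_of_mul_eq_mul_left (by positivity) h

theorem zpow_eq_one_iff (H : IsMetacyclicPair n t m y x) (i : ℤ) :
    y ^ i = 1 ↔ (2 : ℤ) ^ (n + 1) ∣ i := by
  rw [← orderOf_dvd_iff_zpow_eq_one, H.ord]; norm_cast

theorem zpow_eq_iff (H : IsMetacyclicPair n t m y x) (i j : ℤ) :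
    y ^ i = y ^ j ↔ (2 : ℤ) ^ (n + 1) ∣ i - j := by
  rw [← H.zpow_eq_one_iff, zpow_sub, mul_inv_eq_one]

theorem zpow_mul_x (H : IsMetacyclicPair n t m y x) (i : ℤ) : y ^ i * x = x * y ^ (t * i) := by
  have h : x⁻¹ * y * x = y ^ t := by rw [mul_assoc, H.comm, inv_mul_cancel_left]
  have h2 : (x⁻¹ * y * x) ^ i = x⁻¹ * y ^ i * x := by
    simpa using conj_zpow (i := i) (a := x⁻¹) (b := y)
  rw [zpow_mul, ← h, h2]; group

theorem zpow_mul_xy (H : IsMetacyclicPair n t m y x) (i j : ℤ) :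
    y ^ i * (x * y ^ j) = x * y ^ (t * i + j) := by
  rw [← mul_assoc, H.zpow_mul_x, mul_assoc, zpow_add]

theorem xy_mul_zpow (i j : ℤ) : x * y ^ i * y ^ j = x * y ^ (i + j) := by
  rw [mul_assoc, zpow_add]

theorem xy_mul_xy (H : IsMetacyclicPair n t m y x) (i j : ℤ) :
    x * y ^ i * (x * y ^ j) = y ^ (m + t * i + j) := by
  rw [mul_assoc, H.zpow_mul_xy, ← mul_assoc, H.sq, ← zpow_add, add_assoc]

theorem inv_xy (H : IsMetacyclicPair n t m y x) (i : ℤ) :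
    (x * y ^ i)⁻¹ = x * y ^ (-(m + t * i)) := by
  rw [inv_eq_iff_mul_eq_one, H.xy_mul_xy, add_neg_cancel, zpow_zero]

theorem exists_form (H : IsMetacyclicPair n t m y x) (g : G) :
    ∃ i : ℤ, g = y ^ i ∨ g = x * y ^ i := by
  by_cases hg : g ∈ Subgroup.zpowers y
  · obtain ⟨i, rfl⟩ := hg; exact ⟨i, Or.inl rfl⟩
  · have h1 : x⁻¹ * g ∈ Subgroup.zpowers y := by
      rw [Subgroup.mul_mem_iff_of_index_two H.index, inv_mem_iff]
      simp [hg, H.notMem]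
    obtain ⟨i, hi⟩ := h1
    exact ⟨i, Or.inr (by rw [eq_inv_mul_iff_mul_eq] at hi; exact hi.symm)⟩

theorem xy_notMem (H : IsMetacyclicPair n t m y x) (i : ℤ) : x * y ^ i ∉ Subgroup.zpowers y := by
  rw [Subgroup.mul_mem_cancel_right _ (Subgroup.zpow_mem_zpowers y i)]; exact H.notMem

theorem xy_ne (H : IsMetacyclicPair n t m y x) (i j : ℤ) : x * y ^ i ≠ y ^ j := fun h =>
  H.xy_notMem i (h ▸ ⟨j, rfl⟩)

/-- Conjugation by `x²`, a power of `y`, fixes `y`, and it raises `y` to the power `t²`. -/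
theorem dvd_sq_sub_one (H : IsMetacyclicPair n t m y x) : (2 : ℤ) ^ (n + 1) ∣ t * t - 1 := by
  rw [← H.zpow_eq_iff]
  have h : y ^ (1 : ℤ) * (x * x) = (x * x) * y ^ (t * t) := by
    rw [← mul_assoc, H.zpow_mul_x, mul_assoc, H.zpow_mul_x, mul_one, mul_assoc]
  rw [H.sq, ← zpow_add, ← zpow_add, add_comm, zpow_add, zpow_add] at h
  rw [← mul_left_cancel h, zpow_one]

theorem two_dvd_zpow (n : ℕ) : (2 : ℤ) ∣ 2 ^ (n + 1) := dvd_pow_self 2 (by omega)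

theorem odd_t (H : IsMetacyclicPair n t m y x) : Odd t := by
  have h := (two_dvd_zpow n).trans H.dvd_sq_sub_one
  by_contra hc
  rw [Int.not_odd_iff_even] at hc
  have := hc.mul_left t
  obtain ⟨u, hu⟩ := this
  omega

theorem x_conj (H : IsMetacyclicPair n t m y x) (i : ℤ) : x * y ^ i * x⁻¹ = y ^ (t * i) := by
  rw [mul_inv_eq_iff_eq_mul, H.zpow_mul_x, mul_right_inj, H.zpow_eq_iff]
  obtain ⟨u, hu⟩ := H.dvd_sq_sub_one
  exact ⟨-u * i, by linear_combination -i * hu⟩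

/-- Replacing `x` by `x y`. -/
theorem shift (H : IsMetacyclicPair n t m y x) : IsMetacyclicPair n t (m + t + 1) y (x * y) where
  card := H.card
  ord := H.ord
  notMem := by simpa using H.xy_notMem 1
  comm := by
    have := H.zpow_mul_xy 1 1
    rw [zpow_one] at this
    rw [this, mul_assoc, mul_one, zpow_add, zpow_one, mul_right_inj]
    exact ((Commute.refl y).zpow_left t)
  sq := by have := H.xy_mul_xy 1 1; simpa using this

/-- The maximal subgroup generated by `x` and `y²`. -/
def evenSubgroup (H : IsMetacyclicPair n t m y x) (hm : Even m) : Subgroup G where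
  carrier := {g | ∃ i : ℤ, Even i ∧ (g = y ^ i ∨ g = x * y ^ i)}
  one_mem' := ⟨0, by simp⟩
  mul_mem' := by
    rintro _ _ ⟨i, hi, rfl | rfl⟩ ⟨j, hj, rfl | rfl⟩
    · exact ⟨i + j, hi.add hj, Or.inl (zpow_add y i j).symm⟩
    · exact ⟨t * i + j, (hi.mul_left t).add hj, Or.inr (H.zpow_mul_xy i j)⟩
    · exact ⟨i + j, hi.add hj, Or.inr (xy_mul_zpow i j)⟩
    · exact ⟨m + t * i + j, (hm.add (hi.mul_left t)).add hj, Or.inl (H.xy_mul_xy i j)⟩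
  inv_mem' := by
    rintro _ ⟨i, hi, rfl | rfl⟩
    · exact ⟨-i, hi.neg, Or.inl (zpow_neg y i).symm⟩
    · exact ⟨-(m + t * i), (hm.add (hi.mul_left t)).neg, Or.inr (H.inv_xy i)⟩

theorem even_iff_of_zpow_eq (H : IsMetacyclicPair n t m y x) {i j : ℤ} (h : y ^ i = y ^ j) :
    Even i ↔ Even j := by
  have := (two_dvd_zpow n).trans ((H.zpow_eq_iff i j).1 h)
  rw [Int.even_iff, Int.even_iff]
  omega

theorem zpow_mem_even (H : IsMetacyclicPair n t m y x) (hm : Even m) (i : ℤ) :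
    y ^ i ∈ H.evenSubgroup hm ↔ Even i := by
  constructor
  · rintro ⟨j, hj, h | h⟩
    · exact (H.even_iff_of_zpow_eq h).2 hj
    · exact absurd h.symm (H.xy_ne j i)
  · exact fun h => ⟨i, h, Or.inl rfl⟩

theorem xy_mem_even (H : IsMetacyclicPair n t m y x) (hm : Even m) (i : ℤ) :
    x * y ^ i ∈ H.evenSubgroup hm ↔ Even i := by
  constructor
  · rintro ⟨j, hj, h | h⟩
    · exact absurd h (H.xy_ne i j)
    · exact (H.even_iff_of_zpow_eq (mul_left_cancel h)).2 hj
  · exact fun h => ⟨i, h, Or.inr rfl⟩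

theorem even_index (H : IsMetacyclicPair n t m y x) (hm : Even m) :
    (H.evenSubgroup hm).index = 2 := by
  rw [Subgroup.index_eq_two_iff]
  refine ⟨y, fun b => ?_⟩
  obtain ⟨i, rfl | rfl⟩ := H.exists_form b
  · rw [← zpow_add_one, H.zpow_mem_even, H.zpow_mem_even, Int.even_add_one]
    by_cases h : Even i <;> simp [h]
  · rw [mul_assoc, ← zpow_add_one, H.xy_mem_even, H.xy_mem_even, Int.even_add_one]
    by_cases h : Even i <;> simp [h]

theorem mem_zpowers_pow_iff (H : IsMetacyclicPair n t m y x) {d : ℕ} (hd : d ≤ n + 1) (i : ℤ) :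
    y ^ i ∈ Subgroup.zpowers (y ^ (2 ^ d : ℕ)) ↔ (2 : ℤ) ^ d ∣ i := by
  constructor
  · rintro ⟨k, hk⟩
    simp only at hk
    rw [← zpow_natCast, ← zpow_mul, H.zpow_eq_iff] at hk
    have := (pow_dvd_pow (2 : ℤ) hd).trans hk
    push_cast at this
    exact (dvd_sub_right (dvd_mul_right _ _)).1 this
  · rintro ⟨k, rfl⟩
    exact ⟨k, by simp only; rw [← zpow_natCast, ← zpow_mul]; push_cast; rfl⟩

/-- The contribution of an element as a branch element to the Riemann-Hurwitz formula. -/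
noncomputable def _root_.branchWeight (n : ℕ) (c : G) : ℕ := 2 ^ (n + 1) - 2 ^ (n + 1) / orderOf c

theorem orderOf_zpow_dvd_iff (H : IsMetacyclicPair n t m y x) (i : ℤ) {k : ℕ} (hk : k ≤ n + 1) :
    orderOf (y ^ i) ∣ 2 ^ (n + 1 - k) ↔ (2 : ℤ) ^ k ∣ i := by
  rw [orderOf_dvd_iff_pow_eq_one, ← zpow_natCast, ← zpow_mul, H.zpow_eq_one_iff]
  have e : (2 : ℤ) ^ (n + 1) = 2 ^ k * 2 ^ (n + 1 - k) := by rw [← pow_add]; congr 1; omega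
  rw [e]
  push_cast
  exact mul_dvd_mul_iff_right (by positivity)

theorem branchWeight_odd (H : IsMetacyclicPair n t m y x) {i : ℤ} (hi : ¬ Even i) :
    branchWeight n (y ^ i) = 2 ^ (n + 1) - 1 := by
  have h1 := H.orderOf_zpow_dvd_iff i (k := 1) (by omega)
  have h0 := (H.orderOf_zpow_dvd_iff i (k := 0) (by omega)).2 (by simp)
  rw [Nat.sub_zero, Nat.dvd_prime_pow Nat.prime_two] at h0
  obtain ⟨k, hk, h0⟩ := h0
  rw [pow_one, ← even_iff_two_dvd] at h1
  rw [h0] at h1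
  have hk1 : k = n + 1 := by
    by_contra hc
    exact hi (h1.1 (pow_dvd_pow 2 (by omega)))
  rw [branchWeight, h0, hk1, Nat.div_self (by positivity)]

/-- For an element of order `2 ^ k` the half-weight is the generator `2 ^ n - 2 ^ (n - k)`. The last
clause, used when there is a single handle, says that exponents `2 mod 4` give full order `2 ^ n` in
`⟨y²⟩`. -/
theorem branchWeight_even (H : IsMetacyclicPair n t m y x) {i : ℤ} (hi : Even i) (h : y ^ i ≠ 1) :
    ∃ v ∈ weightMonoid n, branchWeight n (y ^ i) = 2 * v ∧ (¬ (4 : ℤ) ∣ i → v = 2 ^ n - 1) := by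
  have h1 := (H.orderOf_zpow_dvd_iff i (k := 1) (by omega)).2 (by simpa using hi.two_dvd)
  rw [Nat.dvd_prime_pow Nat.prime_two] at h1
  obtain ⟨k, hk, h1⟩ := h1
  have hk0 : k ≠ 0 := by
    rintro rfl
    exact h (orderOf_eq_one_iff.1 h1)
  refine ⟨2 ^ n - 2 ^ (n - k), weightMonoid.gen_mem (by omega), ?_, fun h4 => ?_⟩
  · rw [branchWeight, h1, Nat.pow_div (by omega) (by norm_num), Nat.mul_sub, ← pow_succ', ← pow_succ',
      show n + 1 - k = n - k + 1 by omega]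
  · have h2 := H.orderOf_zpow_dvd_iff i (k := 2) (by omega)
    rw [h1] at h2
    have hkn : k = n := by
      by_contra hc
      exact h4 (by simpa using h2.1 (pow_dvd_pow 2 (by omega)))
    rw [hkn, Nat.sub_self, pow_zero]

/-- An element of prescribed even half-weight. -/
theorem exists_branchWeight (H : IsMetacyclicPair n t m y x) {j : ℕ} (hj : j < n) :
    ∃ i : ℤ, Even i ∧ y ^ i ≠ 1 ∧ branchWeight n (y ^ i) = 2 * (2 ^ n - 2 ^ j) ∧
      (1 ≤ j → (4 : ℤ) ∣ i) := by
  have ho : orderOf (y ^ ((2 : ℤ) ^ (j + 1))) = 2 ^ (n - j) := by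
    have : y ^ ((2 : ℤ) ^ (j + 1)) = y ^ (2 ^ (j + 1) : ℕ) := by
      rw [← zpow_natCast]; push_cast; rfl
    rw [this, orderOf_pow' _ (by positivity), H.ord,
      Nat.gcd_eq_right (pow_dvd_pow 2 (by omega)), Nat.pow_div (by omega) (by norm_num)]
    congr 1; omega
  refine ⟨2 ^ (j + 1), (even_two).pow_of_ne_zero (by omega), fun h => ?_, ?_, fun hj1 => ?_⟩
  · rw [h, orderOf_one] at ho
    have := Nat.one_lt_two_pow (n := n - j) (by omega)
    omega
  · rw [branchWeight, ho, Nat.pow_div (by omega) (by norm_num), Nat.mul_sub, ← pow_succ', ← pow_succ',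
      show n + 1 - (n - j) = j + 1 by omega]
  · exact (by norm_num : (4 : ℤ) = 2 ^ 2) ▸ pow_dvd_pow 2 (by omega)

theorem closure_eq_top (H : IsMetacyclicPair n t m y x) {K : Subgroup G} (hx : x ∈ K) (hy : y ∈ K) :
    K = ⊤ := by
  rw [eq_top_iff]
  intro g _
  obtain ⟨i, rfl | rfl⟩ := H.exists_form g
  · exact zpow_mem hy i
  · exact mul_mem hx (zpow_mem hy i)

end IsMetacyclicPair

/-! ### Generating systems as lists of branch elements -/

namespace IsMetacyclicPair

variable {G : Type*} [Group G] {n : ℕ} {t m : ℤ} {y x : G}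

theorem orderOf_dvd (H : IsMetacyclicPair n t m y x) (hm : Even m) (g : G) :
    orderOf g ∣ 2 ^ (n + 1) := by
  obtain ⟨i, rfl | rfl⟩ := H.exists_form g
  · simpa using (H.orderOf_zpow_dvd_iff i (k := 0) (by omega)).2 (by simp)
  · rw [orderOf_dvd_iff_pow_eq_one, pow_succ', pow_mul, pow_two, H.xy_mul_xy, ← zpow_natCast,
      ← zpow_mul, H.zpow_eq_one_iff, pow_succ']
    push_cast
    refine mul_dvd_mul_right ?_ _
    rw [← even_iff_two_dvd]
    have h1 : Even ((t + 1) * i) := (H.odd_t.add_odd odd_one).mul_right i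
    have := hm.add h1
    rwa [add_mul, one_mul, ← add_assoc] at this

theorem cast_branchWeight (H : IsMetacyclicPair n t m y x) (hm : Even m) (g : G) :
    (branchWeight n g : ℚ) = 2 ^ (n + 1) * (1 - 1 / (orderOf g : ℚ)) := by
  have := H.finite
  have h0 : (orderOf g : ℚ) ≠ 0 := by exact_mod_cast (orderOf_pos g).ne'
  rw [branchWeight, Nat.cast_sub (Nat.div_le_self _ _), Nat.cast_div (H.orderOf_dvd hm g) h0]
  push_cast
  ring

/-- The genus spectrum in terms of lists of branch elements. -/
theorem mem_genusSpectrum_iff (H : IsMetacyclicPair n t m y x) (hm : Even m) (g : ℕ) :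
    g ∈ genusSpectrum G ↔ 2 ≤ g ∧ ∃ (h : ℕ) (a b : Fin h → G) (L : List G), (∀ c ∈ L, c ≠ 1) ∧
      (g : ℤ) - 1 = 2 ^ (n + 1) * (2 * (h - 1)) + ((L.map (branchWeight n)).sum : ℕ) ∧
      Subgroup.closure (Set.range a ∪ Set.range b ∪ {c | c ∈ L}) = ⊤ ∧
      (List.ofFn fun i => a i * b i * (a i)⁻¹ * (b i)⁻¹).prod * L.prod = 1 := by
  have := H.finite
  have key : ∀ (r : ℕ) (c : Fin r → G), (((List.ofFn c).map (branchWeight n)).sum : ℚ) =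
      2 ^ (n + 1) * ∑ j, (1 - 1 / (orderOf (c j) : ℚ)) := by
    intro r c
    rw [List.map_ofFn, List.sum_ofFn, Nat.cast_sum, Finset.mul_sum]
    exact Finset.sum_congr rfl fun j _ => H.cast_branchWeight hm (c j)
  have ho : ∀ c : G, 2 ≤ orderOf c ↔ c ≠ 1 := by
    intro c
    have := orderOf_pos c
    rw [Ne, ← orderOf_eq_one_iff]; omega
  have hr : ∀ (r : ℕ) (c : Fin r → G), Set.range c = {d | d ∈ List.ofFn c} := by
    intro r c; ext d; simp [List.mem_ofFn]
  have arith : ∀ (h : ℕ) (S : ℚ) (s : ℕ), (s : ℚ) = 2 ^ (n + 1) * S →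
      (2 * ((g : ℚ) - 1) = (Nat.card G : ℚ) * (2 * ((h : ℚ) - 1) + S) ↔
      (g : ℤ) - 1 = 2 ^ (n + 1) * (2 * (h - 1)) + (s : ℕ)) := by
    intro h S s hs
    rw [← @Int.cast_inj ℚ, H.card]
    push_cast
    rw [hs, pow_succ _ (n + 1)]
    constructor <;> intro h1 <;> linarith
  unfold genusSpectrum
  refine and_congr_right fun hg => ⟨?_, ?_⟩
  · rintro ⟨h, r, k, hk, hRH, a, b, c, hgen, hprod, hord⟩
    refine ⟨h, a, b, List.ofFn c, ?_, ?_, ?_, hprod⟩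
    · intro d hd
      obtain ⟨j, rfl⟩ := (List.mem_ofFn' _ _).1 hd
      rw [← ho, hord]; exact hk j
    · refine (arith h _ _ (key r c)).1 ?_
      simpa only [hord] using hRH
    · rw [← hr]; exact hgen
  · rintro ⟨h, a, b, L, hL, hRH, hgen, hprod⟩
    refine ⟨h, L.length, fun j => orderOf (L.get j), fun j => (ho _).2 (hL _ (L.get_mem j)), ?_,
      a, b, L.get, ?_, ?_, fun j => rfl⟩
    · refine (arith h _ _ ?_).2 hRH
      rw [← key, List.ofFn_get]
    · rw [hr _ L.get, List.ofFn_get]; exact hgen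
    · rw [List.ofFn_get]; exact hprod

/-- Branch elements in `⟨y²⟩` realizing an element of the semigroup. -/
theorem exists_branch_list (H : IsMetacyclicPair n t m y x) {a : ℕ} (ha : a ∈ weightMonoid n) :
    ∃ (R : List G) (l : ℤ), (∀ c ∈ R, c ≠ 1) ∧ (R.map (branchWeight n)).sum = 2 * a ∧
      R.prod = y ^ (2 * l) ∧ (Even l ∨ ∃ a' ∈ weightMonoid n, a = 2 ^ n - 1 + a') := by
  induction ha using AddSubmonoid.closure_induction with
  | mem v hv =>
    obtain ⟨j, hj, rfl⟩ := hv
    obtain ⟨i, hi, h1, hw, h4⟩ := H.exists_branchWeight hj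
    obtain ⟨l, rfl⟩ := hi.two_dvd
    refine ⟨[y ^ (2 * l)], l, by simpa using h1, by simpa using hw, by simp, ?_⟩
    -- Only `j = 0`, order `2 ^ n`, may produce an odd `l`, and it contributes `2 ^ n - 1`. The
    -- parity of `l` later decides whether a commutator can absorb the product.
    rcases Nat.eq_zero_or_pos j with rfl | hj0
    · exact Or.inr ⟨0, zero_mem _, by simp⟩
    · have := h4 hj0
      exact Or.inl (by rw [Int.even_iff]; omega)
  | zero => exact ⟨[], 0, by simp⟩
  | add a₁ a₂ h₁ h₂ ih₁ ih₂ =>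
    obtain ⟨R₁, l₁, hR₁, hw₁, hp₁, he₁⟩ := ih₁
    obtain ⟨R₂, l₂, hR₂, hw₂, hp₂, he₂⟩ := ih₂
    refine ⟨R₁ ++ R₂, l₁ + l₂, ?_, ?_, ?_, ?_⟩
    · intro c hc
      rcases List.mem_append.1 hc with h | h
      exacts [hR₁ c h, hR₂ c h]
    · rw [List.map_append, List.sum_append, hw₁, hw₂, mul_add]
    · rw [List.prod_append, hp₁, hp₂, ← zpow_add, mul_add]
    · rcases he₁ with he₁ | ⟨b, hb, rfl⟩
      · rcases he₂ with he₂ | ⟨b, hb, rfl⟩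
        · exact Or.inl (he₁.add he₂)
        · exact Or.inr ⟨a₁ + b, add_mem h₁ hb, by ring⟩
      · exact Or.inr ⟨b + a₂, add_mem hb h₂, by ring⟩

theorem commutator_mem_of_index_two {K : Subgroup G} (hK : K.index = 2) (a b : G) :
    a * b * a⁻¹ * b⁻¹ ∈ K := by
  simp only [Subgroup.mul_mem_iff_of_index_two hK, inv_mem_iff]
  tauto

theorem commutator_prod_mem {K : Subgroup G} (hK : K.index = 2) {h : ℕ} (a b : Fin h → G) :
    (List.ofFn fun i => a i * b i * (a i)⁻¹ * (b i)⁻¹).prod ∈ K := by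
  refine Subgroup.list_prod_mem _ fun g hg => ?_
  obtain ⟨i, rfl⟩ := (List.mem_ofFn' _ _).1 hg
  exact commutator_mem_of_index_two hK _ _

theorem zpow_four_normal (H : IsMetacyclicPair n t m y x) :
    (Subgroup.zpowers (y ^ (2 ^ 2 : ℕ))).Normal := by
  refine ⟨?_⟩
  rintro _ ⟨k, rfl⟩ g
  simp only [← zpow_natCast, ← zpow_mul]
  obtain ⟨i, rfl | rfl⟩ := H.exists_form g
  · refine ⟨k, ?_⟩
    simp only [← zpow_mul, ← zpow_neg, ← zpow_add]
    congr 1; ring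
  · refine ⟨t * k, ?_⟩
    have : x * y ^ i * y ^ (((2 ^ 2 : ℕ) : ℤ) * k) * (x * y ^ i)⁻¹ =
        x * y ^ (((2 ^ 2 : ℕ) : ℤ) * k) * x⁻¹ := by
      group
    rw [this, H.x_conj]
    simp only [← zpow_mul]
    congr 1; ring

theorem _root_.Subgroup.commute_of_closure_eq_top {Q : Type*} [Group Q] {S : Set Q}
    (hS : Subgroup.closure S = ⊤) (hc : ∀ a ∈ S, ∀ b ∈ S, Commute a b) (a b : Q) : Commute a b := by
  have h1 : ∀ g : Q, ∀ s ∈ S, Commute s g := by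
    intro g s hs
    have : S ⊆ Subgroup.centralizer {s} := fun u hu =>
      Subgroup.mem_centralizer_singleton_iff.2 (hc u hu s hs).eq
    have := (Subgroup.closure_le _).2 this
    rw [hS] at this
    exact (Subgroup.mem_centralizer_singleton_iff.1 (this (Subgroup.mem_top g))).symm
  have : S ⊆ Subgroup.centralizer {b} := fun u hu =>
    Subgroup.mem_centralizer_singleton_iff.2 (h1 b u hu).eq
  have := (Subgroup.closure_le _).2 this
  rw [hS] at this
  exact Subgroup.mem_centralizer_singleton_iff.1 (this (Subgroup.mem_top a))

/-- With a single handle, not all branch elements lie in `⟨y⁴⟩`. -/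
theorem exists_notMem_of_one_handle (H : IsMetacyclicPair n t m y x) (hn : 1 ≤ n)
    (ht : t % 4 = 3) {a b : G} {L : List G}
    (hgen : Subgroup.closure ({a, b} ∪ {c | c ∈ L}) = ⊤) (hprod : a * b * a⁻¹ * b⁻¹ * L.prod = 1) :
    ∃ c ∈ L, c ∉ Subgroup.zpowers (y ^ (2 ^ 2 : ℕ)) := by
  -- Otherwise `a` and `b` commute modulo the normal subgroup `⟨y⁴⟩` and generate the quotient,
  -- which is then abelian. But `[x, y] = y ^ (t - 1)` with `t - 1 ≡ 2 mod 4`.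
  by_contra! hc
  have := H.zpow_four_normal
  set K := Subgroup.zpowers (y ^ (2 ^ 2 : ℕ)) with hK
  have hab : Commute (QuotientGroup.mk' K a) (QuotientGroup.mk' K b) := by
    have h1 : a * b * a⁻¹ * b⁻¹ ∈ K := by
      rw [eq_inv_of_mul_eq_one_left hprod]
      exact inv_mem (Subgroup.list_prod_mem _ hc)
    rw [← QuotientGroup.eq_one_iff] at h1
    have h2 : (QuotientGroup.mk' K a) * (QuotientGroup.mk' K b) * (QuotientGroup.mk' K a)⁻¹ *
      (QuotientGroup.mk' K b)⁻¹ = 1 := h1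
    rw [mul_inv_eq_one, mul_inv_eq_iff_eq_mul] at h2
    exact h2
  have hL : ∀ c ∈ L, QuotientGroup.mk' K c = 1 := fun c h => (QuotientGroup.eq_one_iff c).2 (hc c h)
  have htop : Subgroup.closure (QuotientGroup.mk' K '' ({a, b} ∪ {c | c ∈ L})) = ⊤ := by
    rw [← MonoidHom.map_closure, hgen, ← MonoidHom.range_eq_map,
      MonoidHom.range_eq_top.2 (QuotientGroup.mk'_surjective K)]
  have hcomm := Subgroup.commute_of_closure_eq_top htop (by
    rintro _ ⟨u, hu, rfl⟩ _ ⟨v, hv, rfl⟩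
    simp only [Set.mem_union, Set.mem_insert_iff, Set.mem_singleton_iff, Set.mem_ofPred_eq] at hu hv
    rcases hu with (rfl | rfl) | hu
    · rcases hv with (rfl | rfl) | hv
      · exact Commute.refl _
      · exact hab
      · rw [hL _ hv]; exact Commute.one_right _
    · rcases hv with (rfl | rfl) | hv
      · exact hab.symm
      · exact Commute.refl _
      · rw [hL _ hv]; exact Commute.one_right _
    · rw [hL _ hu]; exact Commute.one_left _) (QuotientGroup.mk' K x) (QuotientGroup.mk' K y)
  have h3 : (x * y * x⁻¹ * y⁻¹) ∈ K := by
    rw [← QuotientGroup.eq_one_iff]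
    show (QuotientGroup.mk' K x) * (QuotientGroup.mk' K y) * (QuotientGroup.mk' K x)⁻¹ *
      (QuotientGroup.mk' K y)⁻¹ = 1
    rw [mul_inv_eq_one, mul_inv_eq_iff_eq_mul]
    exact hcomm
  have h4 := H.x_conj 1
  rw [zpow_one, mul_one] at h4
  rw [h4, ← zpow_sub_one, hK, H.mem_zpowers_pow_iff (by omega)] at h3
  norm_num at h3
  omega

end IsMetacyclicPair

/-! ### Determination of the genus spectrum in terms of the offset -/

/-- Numerical relations between the half-weights `α`, `β` of the elements `x y²ᵏ` and `x y²ᵏ⁺¹`,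
and the resulting offset `q = α + β - 2ⁿ`. -/
structure IsWeightTriple (n α β q : ℕ) : Prop where
  add_eq : α + β = 2 ^ n + q
  mem_left : α ∈ weightMonoid n
  mem_right : β ∈ weightMonoid n
  double_left : ∃ a ∈ weightMonoid n, 2 * α = 2 ^ n + a
  double_right : ∃ a ∈ weightMonoid n, 2 * β = 2 ^ n + a
  offset_left : ∃ a ∈ weightMonoid n, 2 * α = 2 * q + a
  offset_right : ∃ a ∈ weightMonoid n, 2 * β = 2 * q + a
  offset_pow : ∃ a ∈ weightMonoid n, 2 ^ (n + 1) = 2 * q + a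
  offset_pow_sub : ∃ a ∈ weightMonoid n, 2 * (2 ^ n - 1) = 2 * q + a

namespace IsMetacyclicPair

variable {G : Type*} [Group G] {n : ℕ} {t m : ℤ} {y x : G}

/-- Counting the branch elements by their class modulo `⟨y²⟩`. -/
theorem exists_count (H : IsMetacyclicPair n t m y x) (hn : 1 ≤ n) (hm : Even m)
    (hm' : Even (m + t + 1)) {α β : ℕ}
    (hα : ∀ k : ℤ, Even k → branchWeight n (x * y ^ k) = 2 * α)
    (hβ : ∀ k : ℤ, ¬ Even k → branchWeight n (x * y ^ k) = 2 * β)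
    (L : List G) (hL : ∀ c ∈ L, c ≠ 1) :
    ∃ T u v a : ℕ, a ∈ weightMonoid n ∧
      (L.map (branchWeight n)).sum + T = 2 ^ (n + 1) * T + 2 * (u * α + v * β + a) ∧
      (L.prod ∈ Subgroup.zpowers y ↔ Even (u + v)) ∧
      (L.prod ∈ H.evenSubgroup hm ↔ Even (T + v)) ∧
      (u = 0 → v = 0 → ∀ c ∈ L, c ∈ Subgroup.zpowers y) ∧
      (T = 0 → v = 0 → ∀ c ∈ L, c ∈ H.evenSubgroup hm) ∧
      (T = 0 → u = 0 → ∀ c ∈ L, c ∈ H.shift.evenSubgroup hm') ∧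
      (T = 0 → u = 0 → v = 0 → (∃ c ∈ L, c ∉ Subgroup.zpowers (y ^ (2 ^ 2 : ℕ))) →
        ∃ a' ∈ weightMonoid n, a = 2 ^ n - 1 + a') := by
  -- `T` counts odd powers of `y`, `u` and `v` count elements `x yᵏ` with `k` even and odd, and `a`
  -- is the total half-weight of the even powers of `y`. The summand `T` on the left compensates for
  -- the weight `2 ^ (n + 1) - 1` of an odd power.
  induction L with
  | nil => exact ⟨0, 0, 0, 0, zero_mem _, by simp [one_mem]⟩
  | cons c L ih =>
    obtain ⟨T, u, v, a, ha, hsum, hY, hE, h1, h2, h3, h4⟩ :=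
      ih fun d hd => hL d (List.mem_cons_of_mem _ hd)
    have hc := hL c List.mem_cons_self
    simp only [List.map_cons, List.sum_cons, List.prod_cons, List.forall_mem_cons,
      List.exists_mem_cons_iff, Subgroup.mul_mem_iff_of_index_two H.index,
      Subgroup.mul_mem_iff_of_index_two (H.even_index hm)]
    have hp := Nat.two_pow_pos (n + 1)
    have hyx : y ∈ H.evenSubgroup hm ↔ False := by
      have := H.zpow_mem_even hm 1
      simpa using this
    obtain ⟨i, rfl | rfl⟩ := H.exists_form c
    · have hy : y ^ i ∈ Subgroup.zpowers y := ⟨i, rfl⟩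
      by_cases hi : Even i
      · obtain ⟨w, hw, hbw, hw4⟩ := H.branchWeight_even hi hc
        refine ⟨T, u, v, w + a, add_mem hw ha, by rw [hbw]; linarith, ?_, ?_, ?_, ?_, ?_, ?_⟩
        · simp [hy, hY]
        · simp [H.zpow_mem_even, hi, hE]
        · exact fun a b => ⟨hy, h1 a b⟩
        · exact fun a b => ⟨(H.zpow_mem_even hm i).2 hi, h2 a b⟩
        · exact fun a b => ⟨(H.shift.zpow_mem_even hm' i).2 hi, h3 a b⟩
        · rintro hT hu hv (h | h)
          · rw [H.mem_zpowers_pow_iff (by omega)] at h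
            exact ⟨a, ha, by rw [hw4 (by simpa using h)]⟩
          · obtain ⟨a', ha', rfl⟩ := h4 hT hu hv h
            exact ⟨w + a', add_mem hw ha', by ring⟩
      · refine ⟨T + 1, u, v, a, ha, by rw [H.branchWeight_odd hi]; rw [mul_add]; omega,
          ?_, ?_, ?_, ?_, ?_, ?_⟩
        · simp [hy, hY]
        · rw [H.zpow_mem_even, hE]
          simp only [Nat.even_iff, hi]; simp; omega
        · exact fun a b => ⟨hy, h1 a b⟩
        all_goals intro h; omega
    · have hy := H.xy_notMem i
      by_cases hi : Even i
      · refine ⟨T, u + 1, v, a, ha, by rw [hα i hi]; rw [add_mul]; omega,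
          ?_, ?_, ?_, ?_, ?_, ?_⟩
        · simp only [hy, hY, false_iff, Nat.even_iff]; omega
        · simp [H.xy_mem_even, hi, hE]
        · intro h; omega
        · exact fun a b => ⟨(H.xy_mem_even hm i).2 hi, h2 a b⟩
        · intro _ h; omega
        · intro _ h; omega
      · refine ⟨T, u, v + 1, a, ha, by rw [hβ i hi]; rw [add_mul]; omega,
          ?_, ?_, ?_, ?_, ?_, ?_⟩
        · simp only [hy, hY, false_iff, Nat.even_iff]; omega
        · rw [H.xy_mem_even, hE]
          simp only [Nat.even_iff, hi]; simp; omega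
        · intro _ h; omega
        · intro _ h; omega
        · refine fun a b => ⟨?_, h3 a b⟩
          have h5 := (H.shift.xy_mem_even hm' (i - 1)).2 (by
            rw [Int.even_sub_one]; exact hi)
          rw [mul_assoc, ← zpow_one_add] at h5
          simpa using h5
        · intro _ _ h; omega

end IsMetacyclicPair

namespace IsMetacyclicPair

variable {G : Type*} [Group G] {n : ℕ} {t m : ℤ} {y x : G}

theorem ne_top_of_index_two {K : Subgroup G} (hK : K.index = 2) : K ≠ ⊤ := by
  rintro rfl
  simp at hK

/-- The counts `T`, `u`, `v` have equal parity, because the product of commutators lies in every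
subgroup of index two. In each case the minimal admissible counts yield one of the three families,
and all further handles and branch elements add elements of the semigroup. -/
theorem exists_of_mem_spectrum (H : IsMetacyclicPair n t m y x) (hn : 1 ≤ n) (hm : Even m)
    (ht : t % 4 = 3) {α β q : ℕ} (W : IsWeightTriple n α β q)
    (hα : ∀ k : ℤ, Even k → branchWeight n (x * y ^ k) = 2 * α)
    (hβ : ∀ k : ℤ, ¬ Even k → branchWeight n (x * y ^ k) = 2 * β)
    {g : ℕ} (hg : g ∈ genusSpectrum G) :
    ∃ a ∈ weightMonoid n, g = 2 * q + 2 * a ∨ g = 1 + 4 * q + 2 * a ∨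
      g = 2 ^ (n + 1) - 1 + 2 * a := by
  obtain ⟨-, h, A, B, L, hL, hRH, hgen, hprod⟩ := (H.mem_genusSpectrum_iff hm g).1 hg
  have hm' : Even (m + t + 1) := by
    rw [add_assoc]; exact hm.add (H.odd_t.add_odd odd_one)
  obtain ⟨T, u, v, a, ha, hsum, hY, hE, h1, h2, h3, h4⟩ := H.exists_count hn hm hm' hα hβ L hL
  have hLp := eq_inv_of_mul_eq_one_right hprod
  have huv : Even (u + v) := hY.1 (hLp ▸ inv_mem (commutator_prod_mem H.index A B))
  have hTv : Even (T + v) := hE.1 (hLp ▸ inv_mem (commutator_prod_mem (H.even_index hm) A B))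
  obtain ⟨p, hp⟩ : ∃ p, 2 ^ n = p + 1 := ⟨2 ^ n - 1, by have := Nat.two_pow_pos n; omega⟩
  have hp1 : 2 ^ (n + 1) = 2 * (p + 1) := by rw [pow_succ', hp]
  -- The surplus: `i` comes from handles and, with `j`, from pairs of odd powers of `y`, each worth
  -- `2 ^ n + (2 ^ n - 1)`; `k` and `l` from further elements outside `⟨y⟩`.
  have hmem : ∀ i j k l s : ℕ, s ∈ weightMonoid n →
      i * (p + 1) + j * p + k * α + l * β + s ∈ weightMonoid n := by
    intro i j k l s hs
    have h1 := weightMonoid.pow_mem hn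
    have h2 := weightMonoid.pow_sub_one_mem hn
    rw [hp] at h1 h2
    exact add_mem (add_mem (add_mem (add_mem (nsmul_mem h1 i) (nsmul_mem h2 j))
      (nsmul_mem W.mem_left k)) (nsmul_mem W.mem_right l)) hs
  have hmain : g + 4 * (p + 1) + T = 1 + 4 * (p + 1) * h + 2 * (p + 1) * T +
      2 * (u * α + v * β + a) := by
    have e : ((2 : ℤ) ^ (n + 1)) = 2 * (p + 1) := by exact_mod_cast hp1
    rw [e] at hRH
    rw [hp1] at hsum
    generalize (L.map (branchWeight n)).sum = S at hRH hsum
    zify at hsum ⊢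
    linarith
  have hadd := W.add_eq
  have hpow := W.offset_pow
  rw [hp1] at hpow
  have hdl := W.double_left
  have hdr := W.double_right
  rw [hp] at hadd hdl hdr
  rw [hp1]
  have hthird : ∀ X : ℕ, X ∈ weightMonoid n → g = 1 + 2 * p + 2 * X →
      ∃ a ∈ weightMonoid n, g = 2 * q + 2 * a ∨ g = 1 + 4 * q + 2 * a ∨
      g = 2 * (p + 1) - 1 + 2 * a := fun X hX e => ⟨X, hX, Or.inr (Or.inr (by omega))⟩
  have hsecond : ∀ X : ℕ, X ∈ weightMonoid n → g = 1 + 4 * q + 2 * X →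
      ∃ a ∈ weightMonoid n, g = 2 * q + 2 * a ∨ g = 1 + 4 * q + 2 * a ∨
      g = 2 * (p + 1) - 1 + 2 * a := fun X hX e => ⟨X, hX, Or.inr (Or.inl e)⟩
  by_cases hT : Even T
  · have hv : Even v := (Nat.even_add.1 hTv).1 hT
    have hu : Even u := (Nat.even_add.1 huv).2 hv
    obtain ⟨T, rfl⟩ := hT.two_dvd
    obtain ⟨u, rfl⟩ := hu.two_dvd
    obtain ⟨v, rfl⟩ := hv.two_dvd
    match h with
    | h + 2 =>
      obtain ⟨b, hb, e⟩ := hpow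
      refine hsecond _ (hmem (2 * h + T) T (2 * u) (2 * v) _ (add_mem ha hb)) ?_
      linarith
    | 1 =>
      rcases T with _ | T
      · rcases u with _ | u
        · rcases v with _ | v
          · obtain ⟨c, hc, hc4⟩ := H.exists_notMem_of_one_handle hn ht (a := A 0) (b := B 0) (L := L)
              (by
                rw [← hgen]
                congr 1
                ext z
                simp [eq_comm])
              (by simpa using hprod)
            obtain ⟨b, hb, rfl⟩ := h4 rfl rfl rfl ⟨c, hc, hc4⟩
            refine hthird b hb ?_
            rw [hp, Nat.add_sub_cancel] at hmain
            linarith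
          · obtain ⟨b, hb, e⟩ := W.offset_right
            refine hsecond _ (hmem 0 0 0 (2 * v) _ (add_mem ha hb)) ?_
            linarith
        · obtain ⟨b, hb, e⟩ := W.offset_left
          refine hsecond _ (hmem 0 0 (2 * u) (2 * v) _ (add_mem ha hb)) ?_
          linarith
      · refine hthird _ (hmem (T + 1) T (2 * u) (2 * v) _ ha) ?_
        linarith
    | 0 =>
      -- On the sphere the branch elements generate. Avoiding the three maximal subgroups `⟨y⟩`,
      -- `⟨x, y²⟩`, `⟨x y, y²⟩` means that at least two of `T`, `u`, `v` are nonzero.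
      have hge : ∀ K : Subgroup G, K.index = 2 → ¬ ∀ c ∈ L, c ∈ K := by
        intro K hK hLK
        refine ne_top_of_index_two hK (eq_top_iff.2 ?_)
        rw [← hgen, Subgroup.closure_le]
        rintro c ((⟨i, -⟩ | ⟨i, -⟩) | hc)
        · exact i.elim0
        · exact i.elim0
        · exact hLK c hc
      rcases T with _ | T
      · rcases u with _ | u
        · exact absurd (h3 rfl rfl) (hge _ (H.shift.even_index hm'))
        · rcases v with _ | v
          · exact absurd (h2 rfl rfl) (hge _ (H.even_index hm))
          · refine hsecond _ (hmem 0 0 (2 * u) (2 * v) _ ha) ?_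
            linarith
      · rcases u with _ | u
        · rcases v with _ | v
          · exact absurd (h1 rfl rfl) (hge _ H.index)
          · obtain ⟨b, hb, e⟩ := hdr
            refine hthird _ (hmem T T 0 (2 * v) _ (add_mem ha hb)) ?_
            linarith
        · obtain ⟨b, hb, e⟩ := hdl
          refine hthird _ (hmem T T (2 * u) (2 * v) _ (add_mem ha hb)) ?_
          linarith
  · have hv : ¬ Even v := fun h => hT ((Nat.even_add.1 hTv).2 h)
    have hu : ¬ Even u := fun h => hv ((Nat.even_add.1 huv).1 h)
    rw [Nat.not_even_iff_odd] at hT hu hv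
    obtain ⟨T, rfl⟩ := hT
    obtain ⟨u, rfl⟩ := hu
    obtain ⟨v, rfl⟩ := hv
    refine ⟨_, hmem (2 * h + T) T (2 * u) (2 * v) _ ha, Or.inl ?_⟩
    linarith

/-- Each family is realized by the smallest configuration of its kind, enlarged by a list `R` in
`⟨y²⟩` with half-weight `a`: the sphere with one element of each class, the sphere with two `x yᵏ`
of each parity, and the torus with handle `(x, y)`. One branch exponent is left free to make the
product trivial. -/
theorem mem_spectrum_of_exists (H : IsMetacyclicPair n t m y x) (hn : 2 ≤ n) (hm : Even m)
    (ht : t % 4 = 3) {α β q : ℕ} (W : IsWeightTriple n α β q)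
    (hα : ∀ k : ℤ, Even k → branchWeight n (x * y ^ k) = 2 * α)
    (hβ : ∀ k : ℤ, ¬ Even k → branchWeight n (x * y ^ k) = 2 * β)
    {g a : ℕ} (hg : 2 ≤ g) (ha : a ∈ weightMonoid n)
    (h : g = 2 * q + 2 * a ∨ g = 1 + 4 * q + 2 * a ∨ g = 2 ^ (n + 1) - 1 + 2 * a) :
    g ∈ genusSpectrum G := by
  rw [H.mem_genusSpectrum_iff hm]
  refine ⟨hg, ?_⟩
  have hne : ∀ i : ℤ, x * y ^ i ≠ 1 := fun i hi => H.xy_ne i 0 (by simpa using hi)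
  have hx1 : x ≠ 1 := by simpa using hne 0
  have hxw : branchWeight n x = 2 * α := by simpa using hα 0 (by simp)
  have hxyw : branchWeight n (x * y) = 2 * β := by simpa using hβ 1 (by simp)
  have hxx : ∀ i : ℤ, x * (x * y ^ i) = y ^ (m + i) := fun i => by
    rw [← mul_assoc, H.sq, zpow_add]
  have hne' : ∀ i : ℤ, ¬ Even i → y ^ i ≠ 1 := fun i hi h1 => by
    have := H.even_iff_of_zpow_eq (i := i) (j := 0) (by simpa using h1)
    simp [hi] at this
  obtain ⟨p, hp⟩ : ∃ p, 2 ^ n = p + 1 := ⟨2 ^ n - 1, by have := Nat.two_pow_pos n; omega⟩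
  have hp1 : 2 ^ (n + 1) = 2 * (p + 1) := by rw [pow_succ', hp]
  have e : ((2 : ℤ) ^ (n + 1)) = 2 * (p + 1) := by exact_mod_cast hp1
  have hadd := W.add_eq
  rw [hp] at hadd
  have hyodd : branchWeight n y = 2 ^ (n + 1) - 1 := by
    simpa using H.branchWeight_odd (i := 1) (by simp)
  have htodd := H.odd_t
  have second : ∀ b ∈ weightMonoid n, g = 1 + 4 * q + 2 * b →
      ∃ (h : ℕ) (a b : Fin h → G) (L : List G), (∀ c ∈ L, c ≠ 1) ∧
      (g : ℤ) - 1 = 2 ^ (n + 1) * (2 * (h - 1)) + ((L.map (branchWeight n)).sum : ℕ) ∧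
      Subgroup.closure (Set.range a ∪ Set.range b ∪ {c | c ∈ L}) = ⊤ ∧
      (List.ofFn fun i => a i * b i * (a i)⁻¹ * (b i)⁻¹).prod * L.prod = 1 := by
    intro b hb hgb
    obtain ⟨R, l, hR, hRw, hRp, -⟩ := H.exists_branch_list hb
    have hodd : ¬ Even (-(2 * m + t + 2 * l)) := by
      rw [even_neg, Int.not_even_iff_odd]
      exact (((even_two_mul m).add_odd htodd).add_even (even_two_mul l))
    refine ⟨0, Fin.elim0, Fin.elim0,
      x :: x :: (x * y) :: (x * y ^ (-(2 * m + t + 2 * l))) :: R, ?_, ?_, ?_, ?_⟩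
    · simp only [List.forall_mem_cons]
      exact ⟨hx1, hx1, by simpa using hne 1, hne _, hR⟩
    · simp only [List.map_cons, List.sum_cons, hRw, hxw, hxyw, hβ _ hodd]
      rw [e]
      zify at hadd hgb
      push_cast
      linarith
    · have hx : x ∈ Subgroup.closure (Set.range (Fin.elim0 : Fin 0 → G) ∪
          Set.range (Fin.elim0 : Fin 0 → G) ∪
          {c | c ∈ x :: x :: (x * y) :: (x * y ^ (-(2 * m + t + 2 * l))) :: R}) :=
        Subgroup.subset_closure (by simp)
      refine H.closure_eq_top hx ?_
      rw [← Subgroup.mul_mem_cancel_left _ hx]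
      exact Subgroup.subset_closure (by simp)
    · simp only [List.ofFn_zero, List.prod_nil, one_mul, List.prod_cons, hRp]
      have h1 := H.xy_mul_xy 1 (-(2 * m + t + 2 * l))
      rw [zpow_one] at h1
      rw [← mul_assoc (x * y), h1, ← zpow_add, ← mul_assoc, H.sq, ← zpow_add]
      rw [← zpow_zero y]
      congr 1; ring
  rcases h with h | h | h
  · obtain ⟨R, l, hR, hRw, hRp, -⟩ := H.exists_branch_list ha
    have hodd : ¬ Even (-(m + 1 + 2 * l)) := by
      rw [even_neg, Int.not_even_iff_odd]
      exact (hm.add_odd odd_one).add_even (even_two_mul l)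
    refine ⟨0, Fin.elim0, Fin.elim0, x :: (x * y ^ (-(m + 1 + 2 * l))) :: y :: R, ?_, ?_, ?_, ?_⟩
    · simp only [List.forall_mem_cons]
      exact ⟨hx1, hne _, by simpa using hne' 1 (by simp), hR⟩
    · simp only [List.map_cons, List.sum_cons, hRw, hxw, hβ _ hodd, hyodd]
      rw [e, hp1]
      have : 2 * (p + 1) - 1 = 2 * p + 1 := by omega
      rw [this]
      zify at hadd h
      push_cast
      linarith
    · exact H.closure_eq_top (Subgroup.subset_closure (by simp))
        (Subgroup.subset_closure (by simp))
    · simp only [List.ofFn_zero, List.prod_nil, one_mul, List.prod_cons, hRp]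
      rw [← mul_assoc x, hxx, ← zpow_one_add, ← zpow_add, ← zpow_zero y]
      congr 1; ring
  · exact second a ha h
  -- Since `[x, y] = y ^ (t - 1)`, the extra branch element must be `y ^ (1 - t - 2 l)`. For even
  -- `l` its exponent is `2 mod 4`, so it has half-weight `2 ^ n - 1` as wanted. In the other case
  -- `a` contains a summand `2 ^ n - 1`, and `offset_pow_sub` puts the genus into the second family.
  · obtain ⟨R, l, hR, hRw, hRp, hl | ⟨b, hb, rfl⟩⟩ := H.exists_branch_list ha
    · have h4 : ¬ (4 : ℤ) ∣ 1 - t - 2 * l := by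
        rw [Int.even_iff] at hl; omega
      have hev : Even (1 - t - 2 * l) := by
        rw [Int.even_iff]; omega
      have hn1 : y ^ (1 - t - 2 * l) ≠ 1 := by
        rw [Ne, H.zpow_eq_one_iff]
        exact fun hd => h4 (((by norm_num : (4 : ℤ) = 2 ^ 2) ▸
          pow_dvd_pow 2 (by omega : 2 ≤ n + 1)).trans hd)
      obtain ⟨v, -, hv, hv4⟩ := H.branchWeight_even hev hn1
      refine ⟨1, fun _ => x, fun _ => y, y ^ (1 - t - 2 * l) :: R, ?_, ?_, ?_, ?_⟩
      · simp only [List.forall_mem_cons]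
        exact ⟨hn1, hR⟩
      · simp only [List.map_cons, List.sum_cons, hRw, hv, hv4 h4, hp, Nat.add_sub_cancel]
        rw [hp1] at h
        have h' : g = 2 * p + 1 + 2 * a := by omega
        zify at h'
        push_cast
        linarith
      · exact H.closure_eq_top (Subgroup.subset_closure (by simp))
          (Subgroup.subset_closure (by simp))
      · simp only [List.ofFn_succ, List.ofFn_zero, List.prod_cons, List.prod_nil, mul_one, hRp]
        have := H.x_conj 1
        rw [zpow_one, mul_one] at this
        rw [this, ← zpow_add, ← zpow_sub_one, ← zpow_add, ← zpow_zero y]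
        congr 1; ring
    · obtain ⟨c, hc, hcq⟩ := W.offset_pow_sub
      rw [hp, Nat.add_sub_cancel] at hcq h
      rw [hp1] at h
      exact second _ (add_mem hc hb) (by omega)

end IsMetacyclicPair

/-! ### The offsets and spectra of the three families -/

/-- The set of genera attached to the offset `q`. -/
def offsetSpectrum (n q : ℕ) : Set ℕ :=
  {g | 2 ≤ g ∧ ∃ a ∈ weightMonoid n, g = 2 * q + 2 * a ∨ g = 1 + 4 * q + 2 * a ∨
    g = 2 ^ (n + 1) - 1 + 2 * a}

namespace IsWeightTriple

/-- Involutions have half-weight `2 ^ (n - 1)`, elements of order four `2 ^ n - 2 ^ (n - 2)`.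
Outside `⟨y⟩` the dihedral group has only the former, the quaternion group only the latter, and the
semidihedral group one kind for each parity of the exponent. -/
theorem dihedral {n : ℕ} (hn : 1 ≤ n) : IsWeightTriple n (2 ^ (n - 1)) (2 ^ (n - 1)) 0 := by
  obtain ⟨d, rfl⟩ := Nat.exists_eq_add_of_le' hn
  have e : 2 ^ (d + 1) = 2 * 2 ^ d := pow_succ' 2 d
  have hh := weightMonoid.half_mem hn
  have hp := weightMonoid.pow_mem hn
  have h1 := weightMonoid.pow_sub_one_mem hn
  rw [Nat.add_sub_cancel] at hh ⊢
  exact ⟨by omega, hh, hh, ⟨0, zero_mem _, by omega⟩, ⟨0, zero_mem _, by omega⟩,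
    ⟨_, hp, by omega⟩, ⟨_, hp, by omega⟩, ⟨_, add_mem hp hp, by rw [pow_succ' 2 (d + 1)]; omega⟩,
    ⟨_, add_mem h1 h1, by omega⟩⟩

theorem quaternion {n : ℕ} (hn : 2 ≤ n) :
    IsWeightTriple n (2 ^ n - 2 ^ (n - 2)) (2 ^ n - 2 ^ (n - 2)) (2 ^ (n - 1)) := by
  obtain ⟨d, rfl⟩ := Nat.exists_eq_add_of_le' hn
  have e : 2 ^ (d + 1) = 2 * 2 ^ d := pow_succ' 2 d
  have e2 : 2 ^ (d + 2) = 2 * 2 ^ (d + 1) := pow_succ' 2 (d + 1)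
  have e3 : 2 ^ (d + 2 + 1) = 2 * 2 ^ (d + 2) := pow_succ' 2 (d + 2)
  have hh : 2 ^ (d + 1) ∈ weightMonoid (d + 2) := weightMonoid.half_mem (by omega)
  have hp := weightMonoid.pow_mem (n := d + 2) (by omega)
  have hq := weightMonoid.gen_mem (n := d + 2) (j := d) (by omega)
  have h2 := weightMonoid.gen_mem (n := d + 2) (j := 1) (by omega)
  rw [Nat.add_sub_cancel, show d + 2 - 1 = d + 1 from rfl]
  have := Nat.two_pow_pos d
  exact ⟨by omega, hq, hq, ⟨_, hh, by omega⟩, ⟨_, hh, by omega⟩, ⟨_, hh, by omega⟩,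
    ⟨_, hh, by omega⟩, ⟨_, hp, by omega⟩, ⟨_, h2, by omega⟩⟩

theorem semidihedral {n : ℕ} (hn : 2 ≤ n) :
    IsWeightTriple n (2 ^ (n - 1)) (2 ^ n - 2 ^ (n - 2)) (2 ^ (n - 2)) := by
  obtain ⟨d, rfl⟩ := Nat.exists_eq_add_of_le' hn
  have e : 2 ^ (d + 1) = 2 * 2 ^ d := pow_succ' 2 d
  have e2 : 2 ^ (d + 2) = 2 * 2 ^ (d + 1) := pow_succ' 2 (d + 1)
  have e3 : 2 ^ (d + 2 + 1) = 2 * 2 ^ (d + 2) := pow_succ' 2 (d + 2)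
  have hh : 2 ^ (d + 1) ∈ weightMonoid (d + 2) := weightMonoid.half_mem (by omega)
  have hp := weightMonoid.pow_mem (n := d + 2) (by omega)
  have hq := weightMonoid.gen_mem (n := d + 2) (j := d) (by omega)
  have h2 := weightMonoid.gen_mem (n := d + 2) (j := 1) (by omega)
  rw [Nat.add_sub_cancel, show d + 2 - 1 = d + 1 from rfl]
  have := Nat.two_pow_pos d
  exact ⟨by omega, hh, hq, ⟨0, zero_mem _, by omega⟩, ⟨_, hh, by omega⟩, ⟨_, hh, by omega⟩,
    ⟨_, hp, by omega⟩, ⟨_, add_mem hh hp, by omega⟩, ⟨_, add_mem hh h2, by omega⟩⟩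

end IsWeightTriple

namespace IsMetacyclicPair

variable {G : Type*} [Group G] {n : ℕ} {t m : ℤ} {y x : G}

theorem genusSpectrum_eq (H : IsMetacyclicPair n t m y x) (hn : 2 ≤ n) (hm : Even m)
    (ht : t % 4 = 3) {α β q : ℕ} (W : IsWeightTriple n α β q)
    (hα : ∀ k : ℤ, Even k → branchWeight n (x * y ^ k) = 2 * α)
    (hβ : ∀ k : ℤ, ¬ Even k → branchWeight n (x * y ^ k) = 2 * β) :
    genusSpectrum G = offsetSpectrum n q := by
  ext g
  exact ⟨fun hg => ⟨hg.1, H.exists_of_mem_spectrum (by omega) hm ht W hα hβ hg⟩,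
    fun ⟨hg, a, ha, h⟩ => H.mem_spectrum_of_exists hn hm ht W hα hβ hg ha h⟩

theorem branchWeight_of_sq_eq_one (H : IsMetacyclicPair n t m y x) (hn : 1 ≤ n) {k : ℤ}
    (h : (2 : ℤ) ^ (n + 1) ∣ m + t * k + k) : branchWeight n (x * y ^ k) = 2 * 2 ^ (n - 1) := by
  have ho : orderOf (x * y ^ k) = 2 ^ 1 := by
    rw [pow_one]
    refine orderOf_eq_prime ?_ fun h1 => H.xy_ne k 0 (by simpa using h1)
    rw [pow_two, H.xy_mul_xy, H.zpow_eq_one_iff]; exact h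
  obtain ⟨d, rfl⟩ := Nat.exists_eq_add_of_le' hn
  rw [branchWeight, ho, Nat.pow_div (by omega) (by norm_num), Nat.add_sub_cancel,
    Nat.add_sub_cancel, ← pow_succ', pow_succ' 2 (d + 1)]
  omega

theorem branchWeight_of_sq_ne_one (H : IsMetacyclicPair n t m y x) (hn : 2 ≤ n) {k : ℤ}
    (h : (2 : ℤ) ^ n ∣ m + t * k + k) (h' : ¬ (2 : ℤ) ^ (n + 1) ∣ m + t * k + k) :
    branchWeight n (x * y ^ k) = 2 * (2 ^ n - 2 ^ (n - 2)) := by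
  have ho : orderOf (x * y ^ k) = 2 ^ (1 + 1) := by
    refine orderOf_eq_prime_pow ?_ ?_
    · rw [pow_one, pow_two, H.xy_mul_xy, H.zpow_eq_one_iff]; exact h'
    · rw [pow_succ, pow_one, pow_mul, pow_two (x * y ^ k), H.xy_mul_xy, ← zpow_natCast, ← zpow_mul,
        H.zpow_eq_one_iff, pow_succ]
      exact mul_dvd_mul_right h _
  obtain ⟨d, rfl⟩ := Nat.exists_eq_add_of_le' hn
  rw [branchWeight, ho, Nat.pow_div (by omega) (by norm_num), Nat.add_sub_cancel, Nat.mul_sub,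
    ← pow_succ', ← pow_succ']
  congr 2

theorem not_two_pow_succ_dvd (n : ℕ) {k : ℤ} (hk : ¬ Even k) : ¬ (2 : ℤ) ^ (n + 1) ∣ 2 ^ n * k := by
  rw [pow_succ, mul_dvd_mul_iff_left (by positivity), ← even_iff_two_dvd]
  exact hk

theorem dihedral_spectrum (H : IsMetacyclicPair n (-1) 0 y x) (hn : 2 ≤ n) :
    genusSpectrum G = offsetSpectrum n 0 := by
  have h : ∀ k : ℤ, branchWeight n (x * y ^ k) = 2 * 2 ^ (n - 1) := fun k =>
    H.branchWeight_of_sq_eq_one (by omega) (by ring_nf; simp)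
  exact H.genusSpectrum_eq hn (by simp) (by norm_num) (.dihedral (by omega))
    (fun k _ => h k) (fun k _ => h k)

theorem quaternion_spectrum (H : IsMetacyclicPair n (-1) (2 ^ n) y x) (hn : 2 ≤ n) :
    genusSpectrum G = offsetSpectrum n (2 ^ (n - 1)) := by
  have h : ∀ k : ℤ, branchWeight n (x * y ^ k) = 2 * (2 ^ n - 2 ^ (n - 2)) := fun k => by
    have e : (2 : ℤ) ^ n + -1 * k + k = 2 ^ n * 1 := by ring
    refine H.branchWeight_of_sq_ne_one hn ?_ ?_ <;> rw [e]
    · exact dvd_mul_right _ _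
    · exact not_two_pow_succ_dvd n (by simp)
  exact H.genusSpectrum_eq hn (even_two.pow_of_ne_zero (by omega)) (by norm_num)
    (.quaternion hn) (fun k _ => h k) (fun k _ => h k)

theorem four_dvd (hn : 2 ≤ n) : (4 : ℤ) ∣ 2 ^ n :=
  (by norm_num : (4 : ℤ) = 2 ^ 2) ▸ pow_dvd_pow 2 hn

theorem semidihedral_spectrum (H : IsMetacyclicPair n (2 ^ n - 1) 0 y x) (hn : 2 ≤ n) :
    genusSpectrum G = offsetSpectrum n (2 ^ (n - 2)) := by
  have e : ∀ k : ℤ, 0 + ((2 : ℤ) ^ n - 1) * k + k = 2 ^ n * k := fun k => by ring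
  refine H.genusSpectrum_eq hn (by simp) ?_ (.semidihedral hn) (fun k hk => ?_) (fun k hk => ?_)
  · have := four_dvd hn
    omega
  · refine H.branchWeight_of_sq_eq_one (by omega) ?_
    rw [e, pow_succ]
    exact mul_dvd_mul_left _ hk.two_dvd
  · refine H.branchWeight_of_sq_ne_one hn ?_ ?_ <;> rw [e]
    · exact dvd_mul_right _ _
    · exact not_two_pow_succ_dvd n hk

end IsMetacyclicPair

/-! ### Largest gaps and least elements -/

theorem stable_of_spectrum {G : Type*} [Group G] {s : ℕ}
    (hs : ∀ g, s < g → g ∈ genusSpectrum G) (hs' : s ∉ genusSpectrum G) :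
    IsGenusIncrement G 1 ∧ IsStableUpperGenus G (s + 1) := by
  have hinc : IsGenusIncrement G 1 := by
    refine ⟨one_pos, fun g _ => Nat.modEq_one, (Set.finite_Iic s).subset ?_⟩
    rintro g ⟨-, hg⟩
    exact not_lt.1 fun h => hg (hs g h)
  refine ⟨hinc, 1, hinc, ⟨hs _ (Nat.lt_succ_self s), fun k => hs _ (by omega)⟩, ?_⟩
  rintro g ⟨-, hg⟩
  by_contra hlt
  refine hs' ?_
  have := hg (s - g)
  rwa [one_mul, Nat.add_sub_cancel' (by omega)] at this

namespace offsetSpectrum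

variable {n : ℕ}

/-- The largest even gap. -/
theorem even_gap (hn : 2 ≤ n) (q : ℕ) :
    2 * ((n - 2) * 2 ^ n + 1) + 2 * q ∉ offsetSpectrum n q := by
  rintro ⟨-, a, ha, h | h | h⟩
  · have : a = (n - 2) * 2 ^ n + 1 := by omega
    exact weightMonoid.frobenius_notMem hn (this ▸ ha)
  · omega
  · have := Nat.two_pow_pos n
    rw [pow_succ'] at h
    omega

theorem mem_of_even_gap_lt (hn : 2 ≤ n) {q k : ℕ} (hk : (n - 2) * 2 ^ n + 1 + q < k) :
    2 * k ∈ offsetSpectrum n q :=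
  ⟨by omega, k - q, weightMonoid.mem_of_frobenius_lt hn (by omega), Or.inl (by omega)⟩

/-- For `q = 0` the third family lies inside the second, as `2 ^ n - 1` is in the semigroup. The odd
genera are thus `1 + 2a`, and the Frobenius number gives a gap one above the largest even gap. -/
theorem dihedral_gap (hn : 2 ≤ n) : 2 * ((n - 2) * 2 ^ n + 1) + 1 ∉ offsetSpectrum n 0 := by
  rintro ⟨-, a, ha, h | h | h⟩
  · omega
  · have : a = (n - 2) * 2 ^ n + 1 := by omega
    exact weightMonoid.frobenius_notMem hn (this ▸ ha)
  · have h0 := Nat.two_pow_pos n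
    rw [pow_succ'] at h
    have : 2 ^ n - 1 + a = (n - 2) * 2 ^ n + 1 := by omega
    exact weightMonoid.frobenius_notMem hn
      (this ▸ add_mem (weightMonoid.pow_sub_one_mem (by omega)) ha)

theorem dihedral_stable (hn : 2 ≤ n) {g : ℕ} (hg : 2 * ((n - 2) * 2 ^ n + 1) + 1 < g) :
    g ∈ offsetSpectrum n 0 := by
  obtain ⟨k, rfl | rfl⟩ := Nat.even_or_odd' g
  · exact mem_of_even_gap_lt hn (by omega)
  · exact ⟨by omega, k, weightMonoid.mem_of_frobenius_lt hn (by omega), Or.inr (Or.inl (by omega))⟩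

/-- For odd `g = 2k + 1` put `z = k - 2q`, here with `2q = 2 ^ n`. The second family needs `z` in
the semigroup, the third `z + 1`. In this range a gap is `1` modulo `2 ^ (n - 1)`, so `z` and `z +
1` are not both gaps. -/
theorem quaternion_stable (hn : 3 ≤ n) {g : ℕ}
    (hg : 2 * ((n - 2) * 2 ^ n + 1) + 2 * 2 ^ (n - 1) < g) : g ∈ offsetSpectrum n (2 ^ (n - 1)) := by
  obtain ⟨k, rfl | rfl⟩ := Nat.even_or_odd' g
  · exact mem_of_even_gap_lt (by omega) (by omega)
  · obtain ⟨d, rfl⟩ := Nat.exists_eq_add_of_le' hn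
    rw [show d + 3 - 1 = d + 2 from rfl, show d + 3 - 2 = d + 1 from rfl] at *
    have e3 : 2 ^ (d + 3) = 2 * 2 ^ (d + 2) := pow_succ' 2 (d + 2)
    have e2 : 2 ^ (d + 2) = 4 * 2 ^ d := by ring
    have e4 : 2 ^ (d + 3 + 1) = 2 * 2 ^ (d + 3) := pow_succ' 2 (d + 3)
    have h0 := Nat.two_pow_pos d
    have e5 : (d + 1) * 2 ^ (d + 3) = d * 2 ^ (d + 3) + 2 ^ (d + 3) := by ring
    refine ⟨by omega, ?_⟩
    obtain ⟨z, rfl⟩ : ∃ z, k = 2 ^ (d + 3) + z := ⟨k - 2 ^ (d + 3), by omega⟩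
    by_cases hz : z % 2 ^ (d + 2) = 1
    · refine ⟨z + 1, weightMonoid.mem_of_mod_ne (by omega)
        (by rw [show d + 3 - 1 = d + 2 from rfl, show d + 3 - 2 = d + 1 from rfl]; omega) ?_,
        Or.inr (Or.inr (by omega))⟩
      rw [show d + 3 - 1 = d + 2 from rfl, Nat.add_mod, hz, Nat.mod_eq_of_lt (b := 2 ^ (d + 2))
        (a := 1) (by omega), Nat.mod_eq_of_lt (by omega)]
      omega
    · refine ⟨z, weightMonoid.mem_of_mod_ne (by omega)
        (by rw [show d + 3 - 1 = d + 2 from rfl, show d + 3 - 2 = d + 1 from rfl]; omega) ?_,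
        Or.inr (Or.inl (by omega))⟩
      rw [show d + 3 - 1 = d + 2 from rfl, Nat.mod_eq_of_lt (b := 2 ^ (d + 2))
        (a := 1) (by omega)]
      exact hz

theorem semidihedral_stable (hn : 3 ≤ n) {g : ℕ}
    (hg : 2 * ((n - 2) * 2 ^ n + 1) + 2 * 2 ^ (n - 2) < g) : g ∈ offsetSpectrum n (2 ^ (n - 2)) := by
  obtain ⟨k, rfl | rfl⟩ := Nat.even_or_odd' g
  · exact mem_of_even_gap_lt (by omega) (by omega)
  · obtain ⟨d, rfl⟩ := Nat.exists_eq_add_of_le' hn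
    rw [show d + 3 - 2 = d + 1 from rfl] at *
    have e3 : 2 ^ (d + 3) = 2 * 2 ^ (d + 2) := pow_succ' 2 (d + 2)
    have e2 : 2 ^ (d + 2) = 2 * 2 ^ (d + 1) := pow_succ' 2 (d + 1)
    have e1 : 2 ^ (d + 1) = 2 * 2 ^ d := pow_succ' 2 d
    have e4 : 2 ^ (d + 3 + 1) = 2 * 2 ^ (d + 3) := pow_succ' 2 (d + 3)
    have h0 := Nat.two_pow_pos d
    have e5 : (d + 1) * 2 ^ (d + 3) = d * 2 ^ (d + 3) + 2 ^ (d + 3) := by ring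
    refine ⟨by omega, ?_⟩
    obtain ⟨z, rfl⟩ : ∃ z, k = 2 ^ (d + 2) + z := ⟨k - 2 ^ (d + 2), by omega⟩
    by_cases hz : z % 2 ^ (d + 2) = 1
    -- Now the third family needs `z - 2 ^ (d + 2) + 1`, which must not drop below the window of
    -- `mem_of_mod_ne`. It does not: `z` is congruent to the Frobenius number modulo `2 ^ (d + 2)`
    -- and less than one period below it, hence at least equal to it.
    · have hfz : (d + 1) * 2 ^ (d + 3) + 1 ≤ z := by
        have hdiv := Nat.div_add_mod z (2 ^ (d + 2))
        by_contra hlt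
        have h6 : 2 * d + 2 ≤ z / 2 ^ (d + 2) := by
          by_contra hc
          have := Nat.mul_le_mul_left (2 ^ (d + 2)) (show z / 2 ^ (d + 2) + 1 ≤ 2 * d + 2 by omega)
          rw [mul_add, mul_one, show 2 ^ (d + 2) * (2 * d + 2) = (d + 1) * 2 ^ (d + 3) by ring] at this
          omega
        have := Nat.mul_le_mul_left (2 ^ (d + 2)) h6
        rw [show 2 ^ (d + 2) * (2 * d + 2) = (d + 1) * 2 ^ (d + 3) by ring] at this
        omega
      refine ⟨z - 2 ^ (d + 2) + 1, weightMonoid.mem_of_mod_ne (by omega)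
        (by rw [show d + 3 - 1 = d + 2 from rfl, show d + 3 - 2 = d + 1 from rfl]; omega) ?_,
        Or.inr (Or.inr (by omega))⟩
      have hz' : (z - 2 ^ (d + 2)) % 2 ^ (d + 2) = 1 := by
        rw [← Nat.mod_eq_sub_mod (by omega)]; exact hz
      rw [show d + 3 - 1 = d + 2 from rfl, Nat.add_mod, hz', Nat.mod_eq_of_lt (b := 2 ^ (d + 2))
        (a := 1) (by omega), Nat.mod_eq_of_lt (by omega)]
      omega
    · refine ⟨z, weightMonoid.mem_of_mod_ne (by omega)
        (by rw [show d + 3 - 1 = d + 2 from rfl, show d + 3 - 2 = d + 1 from rfl]; omega) ?_,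
        Or.inr (Or.inl (by omega))⟩
      rw [show d + 3 - 1 = d + 2 from rfl, Nat.mod_eq_of_lt (b := 2 ^ (d + 2))
        (a := 1) (by omega)]
      exact hz

/-- With `q = 0` the choice `a = 0` gives only the values 0 and 1 in the first two families,
excluded by `2 ≤ g`. The least nonzero element `2 ^ (n - 1)` of the semigroup decides. For `q > 0`
the minimum is `2q`, from `a = 0`. -/
theorem dihedral_isLeast (hn : 1 ≤ n) : IsLeast (offsetSpectrum n 0) (2 ^ n) := by
  have e : 2 ^ n = 2 * 2 ^ (n - 1) := by rw [← pow_succ', Nat.sub_add_cancel hn]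
  have e' : 2 ^ (n + 1) = 2 * 2 ^ n := pow_succ' 2 n
  have h0 := Nat.two_pow_pos (n - 1)
  refine ⟨⟨by omega, _, weightMonoid.half_mem hn, Or.inl (by omega)⟩, ?_⟩
  rintro g ⟨hg, a, ha, h | h | h⟩
  · have := weightMonoid.half_le_of_mem ha (by omega)
    omega
  · have := weightMonoid.half_le_of_mem ha (by omega)
    omega
  · omega

theorem quaternion_isLeast (hn : 1 ≤ n) : IsLeast (offsetSpectrum n (2 ^ (n - 1))) (2 ^ n) := by
  have e : 2 ^ n = 2 * 2 ^ (n - 1) := by rw [← pow_succ', Nat.sub_add_cancel hn]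
  have e' : 2 ^ (n + 1) = 2 * 2 ^ n := pow_succ' 2 n
  have h0 := Nat.two_pow_pos (n - 1)
  refine ⟨⟨by omega, 0, zero_mem _, Or.inl (by omega)⟩, ?_⟩
  rintro g ⟨hg, a, ha, h | h | h⟩ <;> omega

theorem semidihedral_isLeast (hn : 2 ≤ n) :
    IsLeast (offsetSpectrum n (2 ^ (n - 2))) (2 ^ (n - 1)) := by
  have e : 2 ^ (n - 1) = 2 * 2 ^ (n - 2) := by
    rw [← pow_succ']; congr 1; omega
  have e' : 2 ^ (n + 1) = 4 * 2 ^ (n - 1) := by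
    rw [show 4 = 2 ^ 2 from rfl, ← pow_add]; congr 1; omega
  have h0 := Nat.two_pow_pos (n - 2)
  refine ⟨⟨by omega, 0, zero_mem _, Or.inl (by omega)⟩, ?_⟩
  rintro g ⟨hg, a, ha, h | h | h⟩ <;> omega

end offsetSpectrum

/-! ### Isomorphism type, centre and nilpotency class -/

namespace IsMetacyclicPair

variable {G G' : Type*} [Group G] [Group G'] {n : ℕ} {t m : ℤ} {y x : G} {y' x' : G'}

theorem map_equiv (H : IsMetacyclicPair n t m y x) (f : G ≃* G') :
    IsMetacyclicPair n t m (f y) (f x) where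
  card := by rw [← H.card]; exact (Nat.card_congr f.toEquiv).symm
  ord := by rw [← H.ord]; exact f.orderOf_eq y
  notMem := by
    rintro ⟨k, hk⟩
    simp only at hk
    rw [← map_zpow, f.injective.eq_iff] at hk
    exact H.notMem ⟨k, hk⟩
  comm := by rw [← map_mul, H.comm, map_mul, map_zpow]
  sq := by rw [← map_mul, H.sq, map_zpow]

/-- The normal form of an element: `(false, i)` stands for `yⁱ` and `(true, i)` for `x yⁱ`. -/
def normalForm (y x : G) (p : Bool × ℤ) : G := cond p.1 (x * y ^ p.2) (y ^ p.2)

theorem normalForm_surjective (H : IsMetacyclicPair n t m y x) :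
    Function.Surjective (normalForm y x) := fun g => by
  obtain ⟨i, rfl | rfl⟩ := H.exists_form g
  exacts [⟨(false, i), rfl⟩, ⟨(true, i), rfl⟩]

theorem normalForm_eq_iff (H : IsMetacyclicPair n t m y x) (p q : Bool × ℤ) :
    normalForm y x p = normalForm y x q ↔ p.1 = q.1 ∧ (2 : ℤ) ^ (n + 1) ∣ p.2 - q.2 := by
  obtain ⟨_ | _, i⟩ := p <;> obtain ⟨_ | _, j⟩ := q
  · simpa [normalForm] using H.zpow_eq_iff i j
  · simpa [normalForm] using (H.xy_ne j i).symm
  · simpa [normalForm] using H.xy_ne i j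
  · simpa [normalForm] using H.zpow_eq_iff i j

/-- The multiplication of normal forms. -/
def normalMul (t m : ℤ) : Bool × ℤ → Bool × ℤ → Bool × ℤ
  | (false, i), (false, j) => (false, i + j)
  | (false, i), (true, j) => (true, t * i + j)
  | (true, i), (false, j) => (true, i + j)
  | (true, i), (true, j) => (false, m + t * i + j)

theorem normalForm_mul (H : IsMetacyclicPair n t m y x) (p q : Bool × ℤ) :
    normalForm y x p * normalForm y x q = normalForm y x (normalMul t m p q) := by
  obtain ⟨_ | _, i⟩ := p <;> obtain ⟨_ | _, j⟩ := q
  · exact (zpow_add y i j).symm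
  · exact H.zpow_mul_xy i j
  · exact xy_mul_zpow i j
  · exact H.xy_mul_xy i j

/-- The parameters determine the group. -/
theorem nonempty_mulEquiv (H : IsMetacyclicPair n t m y x) (H' : IsMetacyclicPair n t m y' x') :
    Nonempty (G ≃* G') := by
  set s := Function.surjInv H.normalForm_surjective
  have hs : ∀ g, normalForm y x (s g) = g := Function.surjInv_eq H.normalForm_surjective
  have key : ∀ p q, normalForm y x p = normalForm y x q ↔ normalForm y' x' p = normalForm y' x' q :=
    fun p q => by rw [H.normalForm_eq_iff, H'.normalForm_eq_iff]
  refine ⟨MulEquiv.ofBijective (MonoidHom.mk' (fun g => normalForm y' x' (s g)) ?_) ⟨?_, ?_⟩⟩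
  · intro g h
    rw [H'.normalForm_mul, ← key, hs, ← H.normalForm_mul, hs, hs]
  · intro g h hgh
    have := (key _ _).2 hgh
    rwa [hs, hs] at this
  · intro g
    obtain ⟨p, rfl⟩ := H'.normalForm_surjective g
    exact ⟨normalForm y x p, (key _ _).1 (hs _)⟩

theorem dihedralGroup (n : ℕ) :
    IsMetacyclicPair n (-1) 0 (.r 1 : DihedralGroup (2 ^ (n + 1))) (.sr 0) where
  card := by rw [DihedralGroup.nat_card, ← pow_succ']
  ord := DihedralGroup.orderOf_r_one
  notMem := by
    rintro ⟨k, hk⟩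
    simp at hk
  comm := by simp
  sq := by simp

theorem quaternionGroup (n : ℕ) :
    IsMetacyclicPair n (-1) (2 ^ n) (.a 1 : QuaternionGroup (2 ^ n)) (.xa 0) := by
  have hp : ∀ k : ℕ, (QuaternionGroup.a 1 : QuaternionGroup (2 ^ n)) ^ k = .a k :=
    QuaternionGroup.a_one_pow
  have hz : ∀ k : ℤ, ∃ i, (QuaternionGroup.a 1 : QuaternionGroup (2 ^ n)) ^ k = .a i := by
    rintro (k | k)
    · exact ⟨k, by simp⟩
    · exact ⟨-(k + 1 : ℕ), by rw [zpow_negSucc, hp]; rfl⟩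
  refine ⟨?_, ?_, ?_, ?_, ?_⟩
  · rw [Nat.card_eq_fintype_card, QuaternionGroup.card]; ring
  · rw [QuaternionGroup.orderOf_a_one, ← pow_succ']
  · rintro ⟨k, hk⟩
    obtain ⟨i, hi⟩ := hz k
    simp only [hi] at hk
    cases hk
  · have : (QuaternionGroup.a 1 : QuaternionGroup (2 ^ n))⁻¹ = .a (-1) := rfl
    simp [this]
  · have := hp (2 ^ n)
    rw [← zpow_natCast] at this
    push_cast at this
    rw [this]
    simp

theorem semidihedralGroup {n : ℕ} (hn : 1 ≤ n) :
    IsMetacyclicPair n (2 ^ n - 1) 0 (.r 1 : SemidihedralGroup (2 ^ (n - 1))) (.sr 0) := by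
  have hp : ∀ k : ℕ, (SemidihedralGroup.r 1 : SemidihedralGroup (2 ^ (n - 1))) ^ k = .r k := by
    intro k
    induction k with
    | zero => simp [SemidihedralGroup.one_def]
    | succ k ih => rw [pow_succ, ih, SemidihedralGroup.r_mul_r]; push_cast; rfl
  have hz : ∀ k : ℤ, (SemidihedralGroup.r 1 : SemidihedralGroup (2 ^ (n - 1))) ^ k = .r k := by
    rintro (k | k)
    · simp [hp]
    · rw [zpow_negSucc, hp, SemidihedralGroup.inv_r]; simp
  obtain ⟨d, rfl⟩ := Nat.exists_eq_add_of_le' hn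
  have e : 4 * 2 ^ d = 2 ^ (d + 1 + 1) := by ring
  refine ⟨?_, ?_, ?_, ?_, ?_⟩
  · rw [SemidihedralGroup.card_eq, Nat.add_sub_cancel]; ring
  · refine Nat.dvd_antisymm ?_ ?_
    · rw [orderOf_dvd_iff_pow_eq_one, hp, ← e, SemidihedralGroup.one_def]
      congr 1
      exact ZMod.natCast_self _
    · have := pow_orderOf_eq_one (SemidihedralGroup.r 1 : SemidihedralGroup (2 ^ (d + 1 - 1)))
      rw [hp, SemidihedralGroup.one_def, SemidihedralGroup.r.injEq, ZMod.natCast_eq_zero_iff] at this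
      rwa [← e]
  · rintro ⟨k, hk⟩
    simp only [hz] at hk
    cases hk
  · rw [hz, SemidihedralGroup.r_mul_sr, SemidihedralGroup.sr_mul_r, SemidihedralGroup.twist]
    simp [pow_succ', -mul_eq_mul_left_iff]
  · simp [SemidihedralGroup.one_def]

/-- `t - 1` is twice an odd number. -/
theorem pow_succ_dvd_iff (n : ℕ) (ht : t % 4 = 3) (i : ℤ) :
    (2 : ℤ) ^ (n + 1) ∣ t * i - i ↔ (2 : ℤ) ^ n ∣ i := by
  have hodd : IsCoprime ((2 : ℤ) ^ n) ((t - 1) / 2) := by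
    refine IsCoprime.pow_left ?_
    refine (Int.prime_two.coprime_iff_not_dvd).2 ?_
    omega
  have ht2 : t - 1 = 2 * ((t - 1) / 2) := by omega
  rw [show t * i - i = 2 * (((t - 1) / 2) * i) by linear_combination i * ht2, pow_succ',
    mul_dvd_mul_iff_left (by norm_num)]
  exact ⟨hodd.dvd_of_dvd_mul_left, fun h => h.mul_left _⟩

theorem center_eq (H : IsMetacyclicPair n t m y x) (hn : 1 ≤ n) (ht : t % 4 = 3) :
    Subgroup.center G = Subgroup.zpowers (y ^ (2 ^ n : ℕ)) := by
  have h4 : (4 : ℤ) ∣ 2 ^ (n + 1) := (by norm_num : (4 : ℤ) = 2 ^ 2) ▸ pow_dvd_pow 2 (by omega)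
  ext g
  obtain ⟨i, rfl | rfl⟩ := H.exists_form g
  · rw [H.mem_zpowers_pow_iff (by omega), Subgroup.mem_center_iff]
    constructor
    · intro h
      have := h x
      rw [H.zpow_mul_x, mul_right_inj, eq_comm, H.zpow_eq_iff, pow_succ_dvd_iff n ht] at this
      exact this
    · intro h g
      obtain ⟨j, rfl | rfl⟩ := H.exists_form g
      · rw [← zpow_add, ← zpow_add, add_comm]
      · rw [H.zpow_mul_xy, xy_mul_zpow, mul_right_inj, eq_comm, H.zpow_eq_iff]
        rw [show t * i + j - (j + i) = t * i - i by ring, pow_succ_dvd_iff n ht]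
        exact h
  · constructor
    · intro h
      have := Subgroup.mem_center_iff.1 h (y ^ (1 : ℤ))
      rw [H.zpow_mul_xy, xy_mul_zpow, mul_right_inj, H.zpow_eq_iff] at this
      have := h4.trans this
      omega
    · intro h
      refine absurd ?_ (H.xy_notMem i)
      exact (Subgroup.zpowers_le.2 (Subgroup.npow_mem_zpowers y _)) h

theorem card_center (H : IsMetacyclicPair n t m y x) (hn : 1 ≤ n) (ht : t % 4 = 3) :
    Nat.card (Subgroup.center G) = 2 := by
  rw [H.center_eq hn ht, Nat.card_zpowers, orderOf_pow' _ (by positivity), H.ord,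
    Nat.gcd_eq_right (pow_dvd_pow 2 (by omega)), Nat.pow_div (by omega) (by norm_num)]
  simp

/-- The integers `t` and `m` stay the same while `n` drops by one, so the nilpotency class can be
computed by induction, down to a group of order four. -/
theorem quotient_center {n : ℕ} (H : IsMetacyclicPair (n + 1) t m y x) (ht : t % 4 = 3) :
    IsMetacyclicPair n t m (y : G ⧸ Subgroup.center G) (x : G ⧸ Subgroup.center G) where
  card := by
    have h := Subgroup.card_eq_card_quotient_mul_card_subgroup (Subgroup.center G)
    rw [H.card_center (by omega) ht, H.card, pow_succ] at h
    exact (Nat.eq_of_mul_eq_mul_right (by norm_num) h).symm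
  ord := by
    have key : ∀ k : ℕ, (y : G ⧸ Subgroup.center G) ^ k = 1 ↔ 2 ^ (n + 1) ∣ k := by
      intro k
      rw [← QuotientGroup.mk_pow, QuotientGroup.eq_one_iff, H.center_eq (by omega) ht,
        ← zpow_natCast y k, H.mem_zpowers_pow_iff (by omega)]
      norm_cast
    exact Nat.dvd_antisymm (orderOf_dvd_of_pow_eq_one ((key _).2 dvd_rfl))
      ((key _).1 (pow_orderOf_eq_one _))
  notMem := by
    rintro ⟨k, hk⟩
    simp only at hk
    rw [← QuotientGroup.mk_zpow, QuotientGroup.eq, H.center_eq (by omega) ht] at hk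
    have := (Subgroup.zpowers_le.2 (Subgroup.npow_mem_zpowers y _)) hk
    rw [Subgroup.mul_mem_cancel_left _ (inv_mem (Subgroup.zpow_mem_zpowers y k))] at this
    exact H.notMem this
  comm := by rw [← QuotientGroup.mk_mul, H.comm]; rfl
  sq := by rw [← QuotientGroup.mk_mul, H.sq]; rfl

theorem isPGroup (H : IsMetacyclicPair n t m y x) : IsPGroup 2 G := IsPGroup.of_card H.card

theorem isOfMaximalClass {n : ℕ} : ∀ {G : Type*} [Group G] {t m : ℤ} {y x : G},
    IsMetacyclicPair n t m y x → t % 4 = 3 → IsOfMaximalClass 2 (n + 1) G := by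
  induction n with
  | zero =>
    intro G _ t m y x H ht
    have := H.finite
    have hnil := H.isPGroup.isNilpotent
    refine ⟨H.card, hnil, ?_⟩
    have h1 := Group.IsNilpotent.nilpotencyClass_le_one_iff.2
      (IsPGroup.isMulCommutative_of_card_eq_prime_sq (p := 2) H.card)
    have h0 : Group.nilpotencyClass G ≠ 0 := by
      rw [Ne, Group.nilpotencyClass_zero_iff_subsingleton]
      intro hs
      exact H.notMem (Subsingleton.elim 1 x ▸ one_mem _)
    omega
  | succ n ih =>
    intro G _ t m y x H ht
    have := H.finite
    have hnil := H.isPGroup.isNilpotent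
    refine ⟨H.card, hnil, ?_⟩
    obtain ⟨-, h1, h2⟩ := ih (H.quotient_center ht) ht
    rw [Group.nilpotencyClass_quotient_center] at h2
    omega

end IsMetacyclicPair

/-! ### Classification of the 2-groups of maximal class -/

theorem succ_le_of_two_le_nilpotencyClass (n : ℕ) : ∀ {G : Type*} [Group G], Nat.card G = 2 ^ n →
    2 ≤ Group.nilpotencyClass G → Group.nilpotencyClass G + 1 ≤ n := by
  induction n using Nat.strong_induction_on with
  | _ n ih =>
    intro G _ hG hc
    have hfin : Finite G := Nat.finite_of_card_ne_zero (by rw [hG]; positivity)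
    have hnil := (IsPGroup.of_card hG).isNilpotent
    have hncomm : ¬ IsMulCommutative G := fun h => by
      have := Group.IsNilpotent.nilpotencyClass_le_one_iff.2 h
      omega
    have hn : 3 ≤ n := by
      by_contra hlt
      interval_cases n
      · have := (Nat.card_eq_one_iff_unique.1 (by simpa using hG)).1
        exact hncomm ⟨⟨fun a b => Subsingleton.elim _ _⟩⟩
      · have : IsCyclic G := isCyclic_of_prime_card (p := 2) (by simpa using hG)
        exact hncomm inferInstance
      · exact hncomm (IsPGroup.isMulCommutative_of_card_eq_prime_sq hG)
    obtain ⟨k, hk, hZ⟩ := IsPGroup.card_center_eq_prime_pow hG (by omega)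
    have hcard := Subgroup.card_eq_card_quotient_mul_card_subgroup (Subgroup.center G)
    have hkn : k ≤ n := (Nat.pow_dvd_pow_iff_le_right (show 1 < 2 by norm_num)).1
      (by rw [← hZ, ← hG, hcard]; exact dvd_mul_left _ _)
    have hq : Nat.card (G ⧸ Subgroup.center G) = 2 ^ (n - k) := by
      rw [hZ, hG] at hcard
      refine Nat.eq_of_mul_eq_mul_right (show 0 < 2 ^ k by positivity) ?_
      rw [← hcard, ← pow_add, Nat.sub_add_cancel hkn]
    have hcq := Group.nilpotencyClass_quotient_center (G := G)
    by_cases h3 : 3 ≤ Group.nilpotencyClass G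
    · have := ih (n - k) (by omega) hq (by omega)
      omega
    · omega

namespace IsOfMaximalClass

variable {e : ℕ}

/-- A centre of order `2 ^ k` with `k ≥ 2` would leave a quotient of class `e - 1 ≥ 2` and order `2
^ (e + 1 - k)`, too small for that class. -/
theorem card_center {G : Type*} [Group G] (hG : IsOfMaximalClass 2 e G) (he : 3 ≤ e) :
    Nat.card (Subgroup.center G) = 2 := by
  obtain ⟨hG, hnil, hc⟩ := hG
  have hfin : Finite G := Nat.finite_of_card_ne_zero (by rw [hG]; positivity)
  obtain ⟨k, hk, hZ⟩ := IsPGroup.card_center_eq_prime_pow hG (by omega)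
  have hcard := Subgroup.card_eq_card_quotient_mul_card_subgroup (Subgroup.center G)
  have hkn : k ≤ e + 1 := (Nat.pow_dvd_pow_iff_le_right (show 1 < 2 by norm_num)).1
    (by rw [← hZ, ← hG, hcard]; exact dvd_mul_left _ _)
  have hq : Nat.card (G ⧸ Subgroup.center G) = 2 ^ (e + 1 - k) := by
    rw [hZ, hG] at hcard
    refine Nat.eq_of_mul_eq_mul_right (show 0 < 2 ^ k by positivity) ?_
    rw [← hcard, ← pow_add, Nat.sub_add_cancel hkn]
  have hcq := Group.nilpotencyClass_quotient_center (G := G)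
  have := succ_le_of_two_le_nilpotencyClass _ hq (by omega)
  rw [hZ, show k = 1 by omega, pow_one]

theorem quotient_center {G : Type*} [Group G] (hG : IsOfMaximalClass 2 (e + 1) G) (he : 2 ≤ e) :
    IsOfMaximalClass 2 e (G ⧸ Subgroup.center G) := by
  have hZ := hG.card_center (by omega)
  obtain ⟨hG, hnil, hc⟩ := hG
  have hcard := Subgroup.card_eq_card_quotient_mul_card_subgroup (Subgroup.center G)
  rw [hZ, hG, pow_succ] at hcard
  refine ⟨(Nat.eq_of_mul_eq_mul_right (by norm_num) hcard).symm, inferInstance, ?_⟩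
  rw [Group.nilpotencyClass_quotient_center, hc, Nat.add_sub_cancel]

/-- A `2`-group of maximal class has a cyclic subgroup of index two. -/
theorem exists_orderOf_eq (he : 2 ≤ e) : ∀ {G : Type*} [Group G], IsOfMaximalClass 2 e G →
    ∃ y : G, orderOf y = 2 ^ e := by
  induction e, he using Nat.le_induction with
  | base =>
    rintro G _ ⟨hG, hnil, hc⟩
    have hfin : Finite G := Nat.finite_of_card_ne_zero (by rw [hG]; positivity)
    have hncomm : ¬ IsMulCommutative G := fun h => by
      have := Group.IsNilpotent.nilpotencyClass_le_one_iff.2 h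
      omega
    -- A nonabelian group of order eight without elements of order four would have exponent two,
    -- hence be abelian.
    by_contra! hno
    have hsq : ∀ g : G, g ^ 2 = 1 := by
      intro g
      have hd : orderOf g ∣ 2 ^ 3 := hG ▸ orderOf_dvd_natCard g
      obtain ⟨k, hk, hk'⟩ := (Nat.dvd_prime_pow Nat.prime_two).1 hd
      rw [← orderOf_dvd_iff_pow_eq_one]
      interval_cases k
      · rw [hk']; norm_num
      · rw [hk']; norm_num
      · exact absurd hk' (hno g)
      · have : IsCyclic G := isCyclic_of_orderOf_eq_card g (by rw [hk', hG])
        exact absurd (inferInstance : IsMulCommutative G) hncomm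
    refine hncomm ⟨⟨fun a b => ?_⟩⟩
    have hinv : ∀ g : G, g⁻¹ = g := fun g => by
      rw [inv_eq_iff_mul_eq_one, ← pow_two, hsq]
    rw [← hinv (a * b), mul_inv_rev, hinv, hinv]
  | succ e he ih =>
    intro G _ hG
    have hZ := hG.card_center (by omega)
    obtain ⟨q, hq⟩ := ih (hG.quotient_center he)
    obtain ⟨y, rfl⟩ := QuotientGroup.mk_surjective q
    have hG' := (hG.quotient_center he).1
    refine ⟨y, ?_⟩
    have hz2 : ∀ z ∈ Subgroup.center G, z ^ 2 = 1 := by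
      intro z hz
      have := pow_card_eq_one' (x := (⟨z, hz⟩ : Subgroup.center G))
      rw [hZ] at this
      exact congrArg Subtype.val this
    have hpow : ∀ k : ℕ, y ^ k ∈ Subgroup.center G ↔ 2 ^ e ∣ k := by
      intro k
      rw [← QuotientGroup.eq_one_iff, QuotientGroup.mk_pow, ← orderOf_dvd_iff_pow_eq_one, hq]
    refine orderOf_eq_prime_pow ?_ ?_
    -- If the lift `y` had order only `2 ^ e`, then `w = y ^ (2 ^ (e - 1))` would be a noncentral
    -- involution. But `g y g⁻¹ = yᵗ ζ` with `ζ` central of order at most two, and the even power `2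
    -- ^ (e - 1)` kills `ζ`. So `g w g⁻¹ = wᵗ` is `1` or `w`, and `w` is central.
    · intro h1
      obtain ⟨d, rfl⟩ := Nat.exists_eq_add_of_le' he
      set w := y ^ 2 ^ (d + 1) with hw
      have hw2 : w ^ 2 = 1 := by rw [hw, ← pow_mul, ← pow_succ]; exact h1
      have hwZ : w ∉ Subgroup.center G := by
        rw [hw, hpow]
        exact fun h => absurd ((Nat.pow_dvd_pow_iff_le_right (show 1 < 2 by norm_num)).1 h) (by omega)
      have hidx : (Subgroup.zpowers (y : G ⧸ Subgroup.center G)).index = 2 := by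
        have h := (Subgroup.zpowers (y : G ⧸ Subgroup.center G)).card_mul_index
        rw [Nat.card_zpowers, hq, hG', pow_succ] at h
        exact Nat.eq_of_mul_eq_mul_left (by positivity) h
      have hnorm := Subgroup.normal_of_index_eq_two hidx
      refine hwZ (Subgroup.mem_center_iff.2 fun g => ?_)
      obtain ⟨t, ht⟩ := hnorm.conj_mem _ (Subgroup.mem_zpowers _) (g : G ⧸ Subgroup.center G)
      simp only at ht
      have hζ : (y ^ t)⁻¹ * (g * y * g⁻¹) ∈ Subgroup.center G := by
        rw [← QuotientGroup.eq]; exact ht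
      set ζ := (y ^ t)⁻¹ * (g * y * g⁻¹) with hζ'
      have hg : g * y * g⁻¹ = y ^ t * ζ := by rw [hζ']; group
      have hcomm : Commute (y ^ t) ζ := Subgroup.mem_center_iff.1 hζ _
      have hgw : g * w * g⁻¹ = w ^ t := by
        rw [hw, ← conj_pow, hg, hcomm.mul_pow, pow_succ' 2 d, pow_mul ζ, hz2 ζ hζ, one_pow, mul_one,
          ← pow_succ' 2 d, ← zpow_natCast, ← zpow_natCast, ← zpow_mul, ← zpow_mul, mul_comm]
      have hw1 : w ≠ 1 := fun h => hwZ (h ▸ one_mem _)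
      obtain ⟨u, rfl | rfl⟩ := Int.even_or_odd' t
      · rw [zpow_mul, show w ^ (2 : ℤ) = w ^ 2 by norm_cast, hw2, one_zpow] at hgw
        exact absurd (by simpa using hgw) hw1
      · rw [zpow_add_one, zpow_mul, show w ^ (2 : ℤ) = w ^ 2 by norm_cast, hw2, one_zpow, one_mul,
          mul_inv_eq_iff_eq_mul] at hgw
        exact hgw
    · rw [pow_succ, pow_mul]
      exact hz2 _ ((hpow _).2 dvd_rfl)

end IsOfMaximalClass

namespace IsMetacyclicPair

variable {G : Type*} [Group G] {n : ℕ} {t m : ℤ} {y x : G}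

theorem congr_param (H : IsMetacyclicPair n t m y x) {t' m' : ℤ}
    (ht : (2 : ℤ) ^ (n + 1) ∣ t - t') (hm : (2 : ℤ) ^ (n + 1) ∣ m - m') :
    IsMetacyclicPair n t' m' y x :=
  ⟨H.card, H.ord, H.notMem, by rw [H.comm, (H.zpow_eq_iff t t').2 ht],
    by rw [H.sq, (H.zpow_eq_iff m m').2 hm]⟩

theorem dvd_or_dvd_sub {k : ℤ} (h : (2 : ℤ) ^ n ∣ k) :
    (2 : ℤ) ^ (n + 1) ∣ k - 0 ∨ (2 : ℤ) ^ (n + 1) ∣ k - 2 ^ n := by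
  obtain ⟨u, rfl⟩ := h
  obtain ⟨v, rfl | rfl⟩ := Int.even_or_odd' u
  · exact Or.inl ⟨v, by ring⟩
  · exact Or.inr ⟨v, by ring⟩

end IsMetacyclicPair

/-- Once `t ≡ 3 mod 4` is known, `t² ≡ 1` forces `2 ^ n ∣ t + 1`, and `x²` commuting with `x` forces
`2 ^ n ∣ m`. This leaves four pairs `(t, m)` modulo `2 ^ (n + 1)`, two of which define the same
group. -/
theorem IsOfMaximalClass.exists_pair {G : Type*} [Group G] {n : ℕ} (hn : 2 ≤ n)
    (hG : IsOfMaximalClass 2 (n + 1) G) : ∃ y x : G, IsMetacyclicPair n (-1) 0 y x ∨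
      IsMetacyclicPair n (-1) (2 ^ n) y x ∨ IsMetacyclicPair n (2 ^ n - 1) 0 y x := by
  have hZ := hG.card_center (by omega)
  obtain ⟨y, hy⟩ := hG.exists_orderOf_eq (by omega)
  have hcard := hG.1
  have hfin : Finite G := Nat.finite_of_card_ne_zero (by rw [hcard]; positivity)
  have hidx : (Subgroup.zpowers y).index = 2 := by
    have h := (Subgroup.zpowers y).card_mul_index
    rw [Nat.card_zpowers, hy, hcard, pow_succ 2 (n + 1)] at h
    exact Nat.eq_of_mul_eq_mul_left (by positivity) h
  have hnorm := Subgroup.normal_of_index_eq_two hidx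
  obtain ⟨x, hx⟩ : ∃ x, x ∉ Subgroup.zpowers y := by
    by_contra! h
    rw [(Subgroup.eq_top_iff' _).2 h] at hidx
    simp at hidx
  obtain ⟨t, ht⟩ := hnorm.conj_mem _ (Subgroup.mem_zpowers y) x⁻¹
  obtain ⟨m, hm⟩ : x * x ∈ Subgroup.zpowers y := by
    rw [Subgroup.mul_mem_iff_of_index_two hidx]
  simp only at ht hm
  have H : IsMetacyclicPair n t m y x := ⟨hcard, hy, hx, by rw [ht]; group, hm.symm⟩
  -- If `t ≡ 1 mod 4`, then `y ^ (2 ^ (n - 1))`, of order four, is central, against the centre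
  -- having order two.
  have ht4 : t % 4 = 3 := by
    by_contra hne
    have ht1 : t % 4 = 1 := by
      have := Int.odd_iff.1 H.odd_t
      omega
    obtain ⟨d, rfl⟩ := Nat.exists_eq_add_of_le' hn
    have hle : Subgroup.zpowers (y ^ (2 ^ (d + 1) : ℕ)) ≤ Subgroup.center G := by
      rw [Subgroup.zpowers_le, Subgroup.mem_center_iff]
      intro g
      rw [← zpow_natCast]
      obtain ⟨j, rfl | rfl⟩ := H.exists_form g
      · rw [← zpow_add, ← zpow_add, add_comm]
      · rw [H.zpow_mul_xy, IsMetacyclicPair.xy_mul_zpow, mul_right_inj, eq_comm, H.zpow_eq_iff]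
        refine ⟨t / 4, ?_⟩
        have : t = 4 * (t / 4) + 1 := by omega
        push_cast
        linear_combination (2 : ℤ) ^ (d + 1) * this
    have h1 := Nat.le_of_dvd (by rw [hZ]; norm_num) (Subgroup.card_dvd_of_le hle)
    rw [hZ, Nat.card_zpowers, orderOf_pow' _ (by positivity), hy,
      Nat.gcd_eq_right (pow_dvd_pow 2 (by omega)), Nat.pow_div (by omega) (by norm_num),
      show d + 2 + 1 - (d + 1) = 2 by omega] at h1
    omega
  have ht1 : (2 : ℤ) ^ n ∣ t + 1 := by
    rw [← IsMetacyclicPair.pow_succ_dvd_iff n ht4,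
      show t * (t + 1) - (t + 1) = t * t - 1 by ring]
    exact H.dvd_sq_sub_one
  have hmn : (2 : ℤ) ^ n ∣ m := by
    rw [← IsMetacyclicPair.pow_succ_dvd_iff n ht4, ← H.zpow_eq_iff, ← mul_right_inj x,
      ← H.zpow_mul_x, ← H.sq, mul_assoc]
  rcases IsMetacyclicPair.dvd_or_dvd_sub ht1 with ht' | ht'
  · rcases IsMetacyclicPair.dvd_or_dvd_sub hmn with hm' | hm'
    · exact ⟨y, x, Or.inl (H.congr_param (by simpa using ht') hm')⟩
    · exact ⟨y, x, Or.inr (Or.inl (H.congr_param (by simpa using ht') hm'))⟩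
  · have ht'' : (2 : ℤ) ^ (n + 1) ∣ t - (2 ^ n - 1) := by
      rwa [show t - (2 ^ n - 1) = t + 1 - (2 : ℤ) ^ n by ring]
    rcases IsMetacyclicPair.dvd_or_dvd_sub hmn with hm' | hm'
    · exact ⟨y, x, Or.inr (Or.inr (H.congr_param ht'' hm'))⟩
    -- Here `t = 2 ^ n - 1` and `m = 2 ^ n` modulo `2 ^ (n + 1)`. Passing to `x y` replaces `m` by
    -- `m + t + 1`, which is `0` there.
    · refine ⟨y, x * y, Or.inr (Or.inr (H.shift.congr_param ht'' ?_))⟩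
      have h2 := dvd_add (dvd_add hm' ht') (dvd_refl ((2 : ℤ) ^ (n + 1)))
      rwa [show m - 2 ^ n + (t + 1 - 2 ^ n) + 2 ^ (n + 1) = m + t + 1 - 0 by ring] at h2

/-! ### The theorem -/

theorem theorem3p4 (e : ℕ) (he : 5 ≤ e) :
    (∀ (G : Type*) [Group G],
      (IsOfMaximalClass 2 e G ↔
        Nonempty (G ≃* DihedralGroup (2 ^ e)) ∨
        Nonempty (G ≃* QuaternionGroup (2 ^ (e - 1))) ∨
        Nonempty (G ≃* SemidihedralGroup (2 ^ (e - 2)))) ∧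
      (IsOfMaximalClass 2 e G → IsGenusIncrement G 1) ∧
      (Nonempty (G ≃* DihedralGroup (2 ^ e)) →
        IsMinimumGenus G (2 ^ (e - 1)) ∧
        IsStableUpperGenus G ((e - 3) * 2 ^ e + 4)) ∧
      (Nonempty (G ≃* QuaternionGroup (2 ^ (e - 1))) →
        IsMinimumGenus G (2 ^ (e - 1)) ∧
        IsStableUpperGenus G ((e - 3) * 2 ^ e + 2 ^ (e - 1) + 3)) ∧
      (Nonempty (G ≃* SemidihedralGroup (2 ^ (e - 2))) →
        IsMinimumGenus G (2 ^ (e - 2)) ∧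
        IsStableUpperGenus G ((e - 3) * 2 ^ e + 2 ^ (e - 2) + 3))) ∧
    genusSpectrum (DihedralGroup (2 ^ e)) ≠ genusSpectrum (QuaternionGroup (2 ^ (e - 1))) ∧
    genusSpectrum (DihedralGroup (2 ^ e)) ≠ genusSpectrum (SemidihedralGroup (2 ^ (e - 2))) ∧
    genusSpectrum (QuaternionGroup (2 ^ (e - 1))) ≠
      genusSpectrum (SemidihedralGroup (2 ^ (e - 2))) := by
  obtain ⟨n, rfl⟩ := Nat.exists_eq_add_of_le' (show 1 ≤ e by omega)
  have hn : 4 ≤ n := by omega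
  rw [Nat.add_sub_cancel, show n + 1 - 2 = n - 1 by omega, show n + 1 - 3 = n - 2 by omega]
  have hσ : (n - 2) * 2 ^ (n + 1) = 2 * ((n - 2) * 2 ^ n) := by ring
  have h2n : 2 ^ n = 2 * 2 ^ (n - 1) := by rw [← pow_succ', Nat.sub_add_cancel (by omega)]
  have h2n1 : 2 ^ (n - 1) = 2 * 2 ^ (n - 2) := by
    rw [← pow_succ']; congr 1; omega
  have hpos := Nat.two_pow_pos (n - 2)
  have h4 : (2 ^ n - 1 : ℤ) % 4 = 3 := by
    have := IsMetacyclicPair.four_dvd (n := n) (by omega)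
    omega
  refine ⟨fun G _ => ?_, ?_⟩
  · have D : ∀ {y x : G}, IsMetacyclicPair n (-1) 0 y x → IsMinimumGenus G (2 ^ n) ∧
        IsGenusIncrement G 1 ∧ IsStableUpperGenus G ((n - 2) * 2 ^ (n + 1) + 4) := by
      intro y x H
      have hs := H.dihedral_spectrum (by omega)
      refine ⟨?_, ?_⟩
      · rw [IsMinimumGenus, hs]; exact offsetSpectrum.dihedral_isLeast (by omega)
      · have := stable_of_spectrum (G := G) (s := 2 * ((n - 2) * 2 ^ n + 1) + 1)
          (fun g hg => by rw [hs]; exact offsetSpectrum.dihedral_stable (by omega) hg)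
          (by rw [hs]; exact offsetSpectrum.dihedral_gap (by omega))
        rw [hσ]
        convert this using 2
        omega
    have Q : ∀ {y x : G}, IsMetacyclicPair n (-1) (2 ^ n) y x → IsMinimumGenus G (2 ^ n) ∧
        IsGenusIncrement G 1 ∧ IsStableUpperGenus G ((n - 2) * 2 ^ (n + 1) + 2 ^ n + 3) := by
      intro y x H
      have hs := H.quaternion_spectrum (by omega)
      refine ⟨?_, ?_⟩
      · rw [IsMinimumGenus, hs]; exact offsetSpectrum.quaternion_isLeast (by omega)
      · have := stable_of_spectrum (G := G) (s := 2 * ((n - 2) * 2 ^ n + 1) + 2 * 2 ^ (n - 1))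
          (fun g hg => by rw [hs]; exact offsetSpectrum.quaternion_stable (by omega) hg)
          (by rw [hs]; exact offsetSpectrum.even_gap (by omega) _)
        rw [hσ]
        convert this using 2
        omega
    have S : ∀ {y x : G}, IsMetacyclicPair n (2 ^ n - 1) 0 y x → IsMinimumGenus G (2 ^ (n - 1)) ∧
        IsGenusIncrement G 1 ∧ IsStableUpperGenus G ((n - 2) * 2 ^ (n + 1) + 2 ^ (n - 1) + 3) := by
      intro y x H
      have hs := H.semidihedral_spectrum (by omega)
      refine ⟨?_, ?_⟩
      · rw [IsMinimumGenus, hs]; exact offsetSpectrum.semidihedral_isLeast (by omega)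
      · have := stable_of_spectrum (G := G) (s := 2 * ((n - 2) * 2 ^ n + 1) + 2 * 2 ^ (n - 2))
          (fun g hg => by rw [hs]; exact offsetSpectrum.semidihedral_stable (by omega) hg)
          (by rw [hs]; exact offsetSpectrum.even_gap (by omega) _)
        rw [hσ]
        convert this using 2
        omega
    refine ⟨⟨fun hG => ?_, ?_⟩, fun hG => ?_, ?_, ?_, ?_⟩
    · obtain ⟨y, x, H | H | H⟩ := hG.exists_pair (by omega)
      · exact Or.inl (H.nonempty_mulEquiv (.dihedralGroup n))
      · exact Or.inr (Or.inl (H.nonempty_mulEquiv (.quaternionGroup n)))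
      · exact Or.inr (Or.inr (H.nonempty_mulEquiv (.semidihedralGroup (by omega))))
    · rintro (⟨⟨f⟩⟩ | ⟨⟨f⟩⟩ | ⟨⟨f⟩⟩)
      · exact ((IsMetacyclicPair.dihedralGroup n).map_equiv f.symm).isOfMaximalClass (by norm_num)
      · exact ((IsMetacyclicPair.quaternionGroup n).map_equiv f.symm).isOfMaximalClass (by norm_num)
      · exact ((IsMetacyclicPair.semidihedralGroup (by omega)).map_equiv f.symm).isOfMaximalClass h4
    · obtain ⟨y, x, H | H | H⟩ := hG.exists_pair (by omega)
      exacts [(D H).2.1, (Q H).2.1, (S H).2.1]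
    · rintro ⟨f⟩
      have := D ((IsMetacyclicPair.dihedralGroup n).map_equiv f.symm)
      exact ⟨this.1, this.2.2⟩
    · rintro ⟨f⟩
      have := Q ((IsMetacyclicPair.quaternionGroup n).map_equiv f.symm)
      exact ⟨this.1, this.2.2⟩
    · rintro ⟨f⟩
      have := S ((IsMetacyclicPair.semidihedralGroup (by omega)).map_equiv f.symm)
      exact ⟨this.1, this.2.2⟩
  · rw [(IsMetacyclicPair.dihedralGroup n).dihedral_spectrum (by omega),
      (IsMetacyclicPair.quaternionGroup n).quaternion_spectrum (by omega),
      (IsMetacyclicPair.semidihedralGroup (n := n) (by omega)).semidihedral_spectrum (by omega)]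
    -- For `q > 0` the largest even gap of the offset `q` exceeds every gap of the dihedral
    -- spectrum. The other two spectra differ in their minima.
    have hDq : ∀ q, 0 < q → offsetSpectrum n 0 ≠ offsetSpectrum n q := fun q hq h =>
      offsetSpectrum.even_gap (n := n) (by omega) q
        (h ▸ offsetSpectrum.dihedral_stable (by omega) (by omega))
    refine ⟨hDq _ (by positivity), hDq _ (by positivity), fun h => ?_⟩
    have h1 := (offsetSpectrum.quaternion_isLeast (n := n) (by omega)).2
      (h ▸ (offsetSpectrum.semidihedral_isLeast (n := n) (by omega)).1)
    omega
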